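/- Theorem 3.1. Let $H$ be a complex Hilbert space, and call a family $(T_t)_{t\ge 0}$ of $\sigma$-weakly continuous, completely positive linear maps on $\mathcal B(H)$ a quantum Markov semigroup (QMS) if $T_0=1$, $T_{t+s}=T_tT_s$, $T_t(1)=1$ for all $t,s\ge 0$, and $t\mapsto T_t(A)$ is $\sigma$-weakly continuous for every $A\in\mathcal B(H)$; it is called uniformly continuous if $t\mapsto T_t$ is norm continuous. The generator of a QMS is $L(A)=\lim_{t\to 0^+}\frac1t(T_tA-A)$ ($\sigma$-weak limit), with domain $D(L)$ the set of all $A\in\mathcal B(H)$ for which this limit exists. Let $L$ be the generator of a QMS on $\mathcal B(H)$. Then for every $\epsilon>0$ the map $1-\epsilon L:D(L)\to\mathcal B(H)$ is bijective, and $L_\epsilon=L(1-\epsilon L)^{-1}$ is a bounded linear map on $\mathcal B(H)$ that is the generator (with domain all of $\mathcal B(H)$) of a uniformly continuous QMS on $\mathcal B(H)$. Moreover $$L(A)=\lim_{\epsilon\to 0^+}L_\epsilon(A)\quad\text{$\sigma$-weakly, for all }A\in D(L).$$ Furthermore there exist a family $(\phi_\epsilon)_{\epsilon>0}$ of normal (that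 is, $\sigma$-weakly continuous) completely positive linear maps on $\mathcal B(H)$ and a family $(G_\epsilon)_{\epsilon>0}$ of bounded operators on $H$ such that $$L_\epsilon(A)=\phi_\epsilon(A)+G_\epsilon A+AG_\epsilon^*\quad\text{for all }A\in\mathcal B(H)\text{ and }\epsilon>0,$$ and hence $L(A)=\lim_{\epsilon\to0^+}\bigl(\phi_\epsilon(A)+G_\epsilon A+AG_\epsilon^*\bigr)$ $\sigma$-weakly for all $A\in D(L)$. -/

import Mathlib

open Filter Topology
open scoped NNReal CStarAlgebra

noncomputable section

section SigmaWeak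

variable {H : Type*} [NormedAddCommGroup H] [InnerProductSpace ℂ H]

/-- The σ-weakly continuous functional `A ↦ ∑ₙ ⟨xₙ, A yₙ⟩` on `B(H)` given by two square-summable
sequences of vectors, that is, `A ↦ tr (A K)` for the trace class operator `K = ∑ₙ |yₙ⟩⟨xₙ|`.
Every trace class operator is of this form. -/
def predualFunctional (x y : lp (fun _ : ℕ => H) 2) (A : H →L[ℂ] H) : ℂ :=
  ∑' n, inner ℂ (x n) (A (y n))

variable (H) in
/-- The σ-weak topology of `B(H)`: the coarsest topology that makes all functionals
`A ↦ ∑ₙ ⟨xₙ, A yₙ⟩`, with `(xₙ)` and `(yₙ)` square-summable, continuous. -/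
@[reducible] def sigmaWeak : TopologicalSpace (H →L[ℂ] H) :=
  ⨅ p : lp (fun _ : ℕ => H) 2 × lp (fun _ : ℕ => H) 2,
    TopologicalSpace.induced (predualFunctional p.1 p.2) inferInstance

/-- Convergence `f → A` along the filter `l` in the σ-weak topology. -/
def SigmaWeakTendsto {α : Type*} (f : α → H →L[ℂ] H) (l : Filter α) (A : H →L[ℂ] H) : Prop :=
  Tendsto f l (@nhds _ (sigmaWeak H) A)

/-- A map on `B(H)` is normal if it is σ-weakly continuous. -/
def IsNormalMap (φ : (H →L[ℂ] H) →L[ℂ] (H →L[ℂ] H)) : Prop :=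
  Continuous[sigmaWeak H, sigmaWeak H] φ

variable [CompleteSpace H] in
/-- `φ` is completely positive: for every `n`, applying `φ` to the entries of `n × n` matrices over
`B(H)` maps positive elements of the C⋆-algebra of `n × n` matrices over `B(H)` to positive ones. -/
def IsCompletelyPositive (φ : (H →L[ℂ] H) →L[ℂ] (H →L[ℂ] H)) : Prop :=
  ∀ (n : ℕ) (M : CStarMatrix (Fin n) (Fin n) (H →L[ℂ] H)), 0 ≤ M → 0 ≤ M.map φ

theorem predualFunctional_summable (x y : lp (fun _ : ℕ => H) 2) (A : H →L[ℂ] H) :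
    Summable fun n => inner ℂ (x n) (A (y n)) := by
  have hx : Summable fun n => ‖x n‖ ^ 2 := by
    have := (lp.memℓp x).summable (by norm_num)
    simpa using this
  have hy : Summable fun n => ‖y n‖ ^ 2 := by
    have := (lp.memℓp y).summable (by norm_num)
    simpa using this
  refine Summable.of_norm_bounded ((hx.add hy).mul_left ‖A‖) fun n => ?_
  calc ‖inner ℂ (x n) (A (y n))‖ ≤ ‖x n‖ * (‖A‖ * ‖y n‖) :=
        (norm_inner_le_norm _ _).trans (by gcongr; exact A.le_opNorm _)
    _ ≤ ‖A‖ * (‖x n‖ ^ 2 + ‖y n‖ ^ 2) := by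
        nlinarith [norm_nonneg A, mul_nonneg (norm_nonneg A) (sq_nonneg (‖x n‖ - ‖y n‖)),
          mul_nonneg (norm_nonneg A) (add_nonneg (sq_nonneg ‖x n‖) (sq_nonneg ‖y n‖))]

theorem predualFunctional_add (x y : lp (fun _ : ℕ => H) 2) (A B : H →L[ℂ] H) :
    predualFunctional x y (A + B) = predualFunctional x y A + predualFunctional x y B := by
  simp only [predualFunctional, add_apply, inner_add_right]
  exact (predualFunctional_summable x y A).tsum_add (predualFunctional_summable x y B)

theorem predualFunctional_smul (x y : lp (fun _ : ℕ => H) 2) (c : ℂ) (A : H →L[ℂ] H) :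
    predualFunctional x y (c • A) = c * predualFunctional x y A := by
  simp only [predualFunctional, smul_apply, inner_smul_right]
  exact tsum_mul_left

theorem sigmaWeakTendsto_iff {α : Type*} {f : α → H →L[ℂ] H} {l : Filter α} {A : H →L[ℂ] H} :
    SigmaWeakTendsto f l A ↔ ∀ x y : lp (fun _ : ℕ => H) 2,
      Tendsto (fun a => predualFunctional x y (f a)) l (𝓝 (predualFunctional x y A)) := by
  unfold SigmaWeakTendsto sigmaWeak
  rw [nhds_iInf, tendsto_iInf, Prod.forall]
  refine forall_congr' fun x => forall_congr' fun y => ?_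
  rw [nhds_induced, tendsto_comap_iff]
  rfl

theorem SigmaWeakTendsto.add {α : Type*} {f g : α → H →L[ℂ] H} {l : Filter α} {A B : H →L[ℂ] H}
    (hf : SigmaWeakTendsto f l A) (hg : SigmaWeakTendsto g l B) :
    SigmaWeakTendsto (fun a => f a + g a) l (A + B) := by
  rw [sigmaWeakTendsto_iff] at *
  intro x y
  simpa only [predualFunctional_add] using (hf x y).add (hg x y)

theorem SigmaWeakTendsto.smul {α : Type*} {f : α → H →L[ℂ] H} {l : Filter α} {A : H →L[ℂ] H}
    (c : ℂ) (hf : SigmaWeakTendsto f l A) : SigmaWeakTendsto (fun a => c • f a) l (c • A) := by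
  rw [sigmaWeakTendsto_iff] at *
  intro x y
  simpa only [predualFunctional_smul] using (hf x y).const_mul c

theorem SigmaWeakTendsto.unique {α : Type*} {f : α → H →L[ℂ] H} {l : Filter α} [l.NeBot]
    {A B : H →L[ℂ] H} (hA : SigmaWeakTendsto f l A) (hB : SigmaWeakTendsto f l B) : A = B := by
  rw [sigmaWeakTendsto_iff] at hA hB
  refine ContinuousLinearMap.ext fun v => ext_inner_left ℂ fun u => ?_
  have h := tendsto_nhds_unique (hA (lp.single 2 0 u) (lp.single 2 0 v))
    (hB (lp.single 2 0 u) (lp.single 2 0 v))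
  have key : ∀ C : H →L[ℂ] H,
      predualFunctional (lp.single 2 0 u) (lp.single 2 0 v) C = inner ℂ u (C v) := by
    intro C
    rw [predualFunctional, tsum_eq_single 0]
    · simp
    · intro n hn
      simp [hn]
  rwa [key, key] at h

end SigmaWeak

/-- A quantum dynamical semigroup on `B(H)`. (Completely positive maps are automatically bounded,
so that bundling `T t` as a bounded operator is no restriction.) -/
structure QuantumDynamicalSemigroup (H : Type*) [NormedAddCommGroup H] [InnerProductSpace ℂ H]
    [CompleteSpace H] where
  /-- The maps `T t`, for `t ≥ 0`. -/
  T : ℝ≥0 → (H →L[ℂ] H) →L[ℂ] (H →L[ℂ] H)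
  normal : ∀ t, IsNormalMap (T t)
  completelyPositive : ∀ t, IsCompletelyPositive (T t)
  map_zero : ∀ A, T 0 A = A
  map_add : ∀ t s A, T (t + s) A = T t (T s A)
  sigmaWeak_continuous : ∀ A, Continuous[inferInstance, sigmaWeak H] fun t => T t A

namespace QuantumDynamicalSemigroup

variable {H : Type*} [NormedAddCommGroup H] [InnerProductSpace ℂ H] [CompleteSpace H]
  (S : QuantumDynamicalSemigroup H)

/-- The semigroup is a quantum Markov semigroup (QMS): every `T t` preserves the identity. -/
def IsMarkov : Prop := ∀ t, S.T t 1 = 1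

/-- The semigroup is uniformly continuous: `t ↦ T t` is continuous in the operator norm. -/
def IsUniformlyContinuous : Prop := Continuous S.T

/-- `(1/t) (T t A - A)` converges σ-weakly to `B` as `t → 0⁺`. -/
def GeneratesAt (A B : H →L[ℂ] H) : Prop :=
  SigmaWeakTendsto (fun t : ℝ≥0 => ((t : ℝ) : ℂ)⁻¹ • (S.T t A - A)) (𝓝[>] 0) B

variable {S} in
theorem GeneratesAt.add {A A' B B' : H →L[ℂ] H} (h : S.GeneratesAt A B)
    (h' : S.GeneratesAt A' B') : S.GeneratesAt (A + A') (B + B') := by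
  have := SigmaWeakTendsto.add h h'
  refine this.congr fun t => ?_
  rw [_root_.map_add, ← smul_add]
  congr 1
  abel

variable {S} in
theorem GeneratesAt.smul {A B : H →L[ℂ] H} (c : ℂ) (h : S.GeneratesAt A B) :
    S.GeneratesAt (c • A) (c • B) := by
  have := SigmaWeakTendsto.smul c h
  refine this.congr fun t => ?_
  rw [_root_.map_smul, ← smul_sub, smul_comm]

theorem generatesAt_zero : S.GeneratesAt 0 0 := by
  have h : SigmaWeakTendsto (fun _ : ℝ≥0 => (0 : H →L[ℂ] H)) (𝓝[>] 0) 0 :=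
    sigmaWeakTendsto_iff.2 fun _ _ => tendsto_const_nhds
  refine h.congr fun t => ?_
  simp

variable {S} in
theorem GeneratesAt.unique {A B C : H →L[ℂ] H} (h : S.GeneratesAt A B) (h' : S.GeneratesAt A C) :
    B = C :=
  SigmaWeakTendsto.unique h h'

/-- The infinitesimal generator `L` of the semigroup: its domain consists of the `A` for which
`(1/t) (T t A - A)` converges σ-weakly as `t → 0⁺`, and `L A` is the limit. -/
def generator : (H →L[ℂ] H) →ₗ.[ℂ] (H →L[ℂ] H) where
  domain :=
    { carrier := {A | ∃ B, S.GeneratesAt A B}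
      add_mem' := fun ⟨_, h⟩ ⟨_, h'⟩ => ⟨_, h.add h'⟩
      zero_mem' := ⟨0, S.generatesAt_zero⟩
      smul_mem' := fun c _ ⟨_, h⟩ => ⟨_, h.smul c⟩ }
  toFun :=
    { toFun := fun A => A.2.choose
      map_add' := fun A A' =>
        (A + A').2.choose_spec.unique (A.2.choose_spec.add A'.2.choose_spec)
      map_smul' := fun c A => (c • A).2.choose_spec.unique (A.2.choose_spec.smul c) }

theorem generator_spec (A : S.generator.domain) : S.GeneratesAt A (S.generator A) :=
  A.2.choose_spec

end QuantumDynamicalSemigroup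

/-- `M = L (1 - ε L)⁻¹`: the map `1 - ε L : D(L) → E` is a bijection, and composing its inverse
with `L` gives `M`. -/
def IsResolventComposite {E : Type*} [NormedAddCommGroup E] [NormedSpace ℂ E] (L : E →ₗ.[ℂ] E)
    (ε : ℝ) (M : E →L[ℂ] E) : Prop :=
  ∃ h : Function.Bijective (L.domain.subtype - (ε : ℂ) • L.toFun),
    ∀ A : E, M A = L ((LinearEquiv.ofBijective (L.domain.subtype - (ε : ℂ) • L.toFun) h).symm A)

end

/-!
The average `R = ∫₀^∞ e⁻ˢ T (ε s) ds` of the semigroup over an exponentially distributed time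
inverts `1 - ε L`: the exponential law is memoryless, which turns translation by `T h` into a
rescaling of the tail of the integral, and differentiating at `h = 0` gives `L R = ε⁻¹ (R - 1)`.
Averages of completely positive unital maps are again completely positive and unital. Normality
survives averaging because a positive functional on `B(H)` is σ-weakly continuous if and only if it
loses no mass along the finite rank projections of a Hilbert basis, and by Dini's theorem the mass
lost tends to `0` uniformly on compact sets of times.

Hence the Yosida approximation `L_ε = L R = ε⁻¹ (R - 1)` is already in Lindblad form, with
`φ_ε = ε⁻¹ R` and `G_ε = -(2 ε)⁻¹`. Its exponential `exp (t L_ε) = e^(-t / ε) exp ((t / ε) R)` is a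
norm limit of positive combinations of powers of `R`, and the normal completely positive maps form
a norm closed cone. Finally `L_ε A = R (L A)` for `A ∈ D(L)`, which tends to `L A` as `ε → 0⁺`.
-/

open InnerProductSpace ComplexOrder MeasureTheory

noncomputable section

section SigmaWeakFunctionals

variable {H : Type*} [NormedAddCommGroup H] [InnerProductSpace ℂ H]

/-- The amplification `A ⊗ 1` of an operator, acting entrywise on square-summable sequences. It
turns the functional `predualFunctional x y` into a matrix coefficient. -/
def amplification (A : H →L[ℂ] H) : lp (fun _ : ℕ => H) 2 →L[ℂ] lp (fun _ : ℕ => H) 2 :=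
  lp.mapCLM 2 (fun _ => A) (norm_nonneg A) fun _ => le_rfl

theorem norm_amplification_le (A : H →L[ℂ] H) : ‖amplification A‖ ≤ ‖A‖ :=
  lp.norm_mapCLM_le 2 _ _ _

theorem predualFunctional_eq_inner_amplification (x y : lp (fun _ : ℕ => H) 2) (A : H →L[ℂ] H) :
    predualFunctional x y A = ⟪x, amplification A y⟫_ℂ :=
  (lp.inner_eq_tsum x (amplification A y)).symm

theorem norm_predualFunctional_le (x y : lp (fun _ : ℕ => H) 2) (A : H →L[ℂ] H) :
    ‖predualFunctional x y A‖ ≤ ‖x‖ * ‖y‖ * ‖A‖ := by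
  rw [predualFunctional_eq_inner_amplification]
  calc ‖⟪x, amplification A y⟫_ℂ‖ ≤ ‖x‖ * (‖A‖ * ‖y‖) :=
        (norm_inner_le_norm _ _).trans <| by
          gcongr; exact (amplification A).le_of_opNorm_le (norm_amplification_le A) y
    _ = ‖x‖ * ‖y‖ * ‖A‖ := by ring

theorem predualFunctional_polarization (x y : lp (fun _ : ℕ => H) 2) (A : H →L[ℂ] H) :
    predualFunctional x y A = (predualFunctional (x + y) (x + y) A
      - predualFunctional (x - y) (x - y) A
      - Complex.I * predualFunctional (x + Complex.I • y) (x + Complex.I • y) A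
      + Complex.I * predualFunctional (x - Complex.I • y) (x - Complex.I • y) A) / 4 := by
  have h := congrArg (starRingEnd ℂ) (inner_map_polarization (amplification A).toLinearMap x y)
  simpa only [predualFunctional_eq_inner_amplification, ContinuousLinearMap.coe_coe, map_div₀,
    _root_.map_sub (starRingEnd ℂ), _root_.map_add (starRingEnd ℂ), map_mul, inner_conj_symm,
    Complex.conj_I, map_ofNat, neg_mul, ← sub_eq_add_neg, sub_neg_eq_add] using h

/-- The functional `predualFunctional x y` as an element of the dual of `B(H)`. -/
def predualCLM (x y : lp (fun _ : ℕ => H) 2) : (H →L[ℂ] H) →L[ℂ] ℂ :=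
  LinearMap.mkContinuous
    { toFun := predualFunctional x y
      map_add' := predualFunctional_add x y
      map_smul' := predualFunctional_smul x y }
    (‖x‖ * ‖y‖) (norm_predualFunctional_le x y)

@[simp]
theorem predualCLM_apply (x y : lp (fun _ : ℕ => H) 2) (A : H →L[ℂ] H) :
    predualCLM x y A = predualFunctional x y A := rfl

theorem predualFunctional_single (u v : H) (A : H →L[ℂ] H) :
    predualFunctional (lp.single 2 0 u) (lp.single 2 0 v) A = ⟪u, A v⟫_ℂ := by
  rw [predualFunctional_eq_inner_amplification, lp.inner_single_left]
  simp [amplification]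

theorem predualFunctional_nonneg (x : lp (fun _ : ℕ => H) 2) {A : H →L[ℂ] H} (hA : 0 ≤ A) :
    0 ≤ predualFunctional x x A :=
  tsum_nonneg fun _ => ((ContinuousLinearMap.nonneg_iff_isPositive A).1 hA).inner_nonneg_right _

theorem continuous_predualFunctional (x y : lp (fun _ : ℕ => H) 2) :
    Continuous[sigmaWeak H, inferInstance] (predualFunctional x y) :=
  continuous_iInf_dom (i := (x, y)) continuous_induced_dom

theorem continuous_sigmaWeak_iff {α : Type*} [TopologicalSpace α] {f : α → H →L[ℂ] H} :
    Continuous[inferInstance, sigmaWeak H] f ↔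
      ∀ x y : lp (fun _ : ℕ => H) 2, Continuous fun a => predualFunctional x y (f a) := by
  simp only [continuous_iInf_rng, continuous_induced_rng, Prod.forall, Function.comp_def]

theorem continuous_sigmaWeak_iff_diag {α : Type*} [TopologicalSpace α] {f : α → H →L[ℂ] H} :
    Continuous[inferInstance, sigmaWeak H] f ↔
      ∀ x : lp (fun _ : ℕ => H) 2, Continuous fun a => predualFunctional x x (f a) := by
  rw [continuous_sigmaWeak_iff]
  refine ⟨fun h x => h x x, fun h x y => ?_⟩
  simp_rw [predualFunctional_polarization x y]
  fun_prop

theorem sigmaWeakTendsto_iff_diag {α : Type*} {f : α → H →L[ℂ] H} {l : Filter α} {A : H →L[ℂ] H} :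
    SigmaWeakTendsto f l A ↔ ∀ x : lp (fun _ : ℕ => H) 2,
      Tendsto (fun a => predualFunctional x x (f a)) l (𝓝 (predualFunctional x x A)) := by
  rw [sigmaWeakTendsto_iff]
  refine ⟨fun h x => h x x, fun h x y => ?_⟩
  simp_rw [predualFunctional_polarization x y]
  exact ((((h _).sub (h _)).sub ((h _).const_mul _)).add ((h _).const_mul _)).div_const _

theorem ext_predualFunctional {A B : H →L[ℂ] H}
    (h : ∀ x, predualFunctional x x A = predualFunctional x x B) : A = B :=
  SigmaWeakTendsto.unique (l := pure ()) (f := fun _ => A)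
    (sigmaWeakTendsto_iff_diag.2 fun _ => tendsto_const_nhds)
    (sigmaWeakTendsto_iff_diag.2 fun x => h x ▸ tendsto_const_nhds)

theorem isNormalMap_of_forall_exists_diag {φ : (H →L[ℂ] H) →L[ℂ] (H →L[ℂ] H)}
    (h : ∀ x : lp (fun _ : ℕ => H) 2, ∃ z : lp (fun _ : ℕ => H) 2,
      ∀ A, predualFunctional x x (φ A) = predualFunctional z z A) : IsNormalMap φ := by
  let := sigmaWeak H
  refine continuous_sigmaWeak_iff_diag.2 fun x => ?_
  obtain ⟨z, hz⟩ := h x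
  simpa only [hz] using continuous_predualFunctional z z

theorem apply_extend_zero {ι κ X Y : Type*} [Zero X] [Zero Y] {f : X → Y} (hf : f 0 = 0)
    (e : ι → κ) (x : ι → X) (k : κ) :
    f (Function.extend e x 0 k) = Function.extend e (fun i => f (x i)) 0 k :=
  (Function.apply_extend f e 0 k).trans
    (congrArg (Function.extend e (f ∘ x) · k) (funext fun _ => hf))

theorem exists_predualFunctional_eq_tsum {ι : Type*} {x : ι → H}
    (hx : Summable fun i => ‖x i‖ ^ 2) :
    ∃ z : lp (fun _ : ℕ => H) 2, ∀ A, predualFunctional z z A = ∑' i, ⟪x i, A (x i)⟫_ℂ := by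
  have hsupp : (Function.support x).Countable := by
    simpa [Function.support] using hx.countable_support
  have := hsupp.to_subtype
  obtain ⟨e, he⟩ := exists_injective_nat (Function.support x)
  let y : Function.support x → H := fun i => x i
  have hz : Memℓp (Function.extend e y 0) 2 := memℓp_gen <| by
    simpa using ((summable_extend_zero he).2 (hx.subtype (Function.support x))).congr fun n =>
      (apply_extend_zero (f := fun v : H => ‖v‖ ^ 2) (by simp) e y n).symm
  refine ⟨⟨Function.extend e y 0, hz⟩, fun A => ?_⟩
  calc ∑' n, ⟪Function.extend e y 0 n, A (Function.extend e y 0 n)⟫_ℂ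
      = ∑' n, Function.extend e (fun i => ⟪y i, A (y i)⟫_ℂ) 0 n :=
        tsum_congr (apply_extend_zero (f := fun v : H => ⟪v, A v⟫_ℂ) (by simp) e y)
    _ = ∑' i, ⟪y i, A (y i)⟫_ℂ := tsum_extend_zero he _
    _ = ∑' i, ⟪x i, A (x i)⟫_ℂ :=
        tsum_subtype_eq_of_support_subset (f := fun i => ⟪x i, A (x i)⟫_ℂ) fun i hi h0 =>
          hi (by simp [h0])

end SigmaWeakFunctionals

section PositiveFunctionals

variable {𝔄 : Type*} [CStarAlgebra 𝔄]

theorem sqrt_norm_apply_star_mul_self_le (ψ : 𝔄 →L[ℂ] ℂ) (a : 𝔄) :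
    √‖ψ (star a * a)‖ ≤ √‖ψ‖ * ‖a‖ := by
  rw [← Real.sqrt_sq (norm_nonneg a), ← Real.sqrt_mul (norm_nonneg ψ), sq,
    ← CStarRing.norm_star_mul_self]
  exact Real.sqrt_le_sqrt (ψ.le_opNorm _)

variable [PartialOrder 𝔄] [StarOrderedRing 𝔄] {ψ : 𝔄 →L[ℂ] ℂ}

theorem norm_apply_star_mul_le (hψ : ∀ a, 0 ≤ a → 0 ≤ ψ a) (a b : 𝔄) :
    ‖ψ (star a * b)‖ ≤ √‖ψ (star a * a)‖ * √‖ψ (star b * b)‖ := by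
  let f : 𝔄 →ₚ[ℂ] ℂ := PositiveLinearMap.mk₀ (ψ : 𝔄 →ₗ[ℂ] ℂ) hψ
  have hf (c : 𝔄) : ‖f.toPreGNS c‖ = √‖ψ (star c * c)‖ := by
    rw [f.preGNS_norm_def]
    exact congrArg (√·.re) (Complex.norm_of_nonneg' (hψ _ (star_mul_self_nonneg c))).symm
  have h := norm_inner_le_norm (𝕜 := ℂ) (f.toPreGNS a) (f.toPreGNS b)
  rwa [hf, hf, f.preGNS_inner_def] at h

theorem norm_apply_compression_sub_le (hψ : ∀ a, 0 ≤ a → 0 ≤ ψ a) {p : 𝔄}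
    (hp : IsStarProjection p) (a : 𝔄) :
    ‖ψ (p * a * p) - ψ a‖ ≤ 2 * (√‖ψ‖ * ‖a‖) * √‖ψ (1 - p)‖ := by
  have hq : star (1 - p) * (1 - p) = 1 - p := by
    rw [hp.one_sub.isSelfAdjoint.star_eq, hp.one_sub.isIdempotentElem.eq]
  have hleft : ‖ψ ((1 - p) * a)‖ ≤ √‖ψ‖ * ‖a‖ * √‖ψ (1 - p)‖ := by
    have h := norm_apply_star_mul_le hψ (1 - p) a
    rw [hq, hp.one_sub.isSelfAdjoint.star_eq, mul_comm] at h
    exact h.trans (by gcongr; exact sqrt_norm_apply_star_mul_self_le ψ a)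
  have hright : ‖ψ (p * a * (1 - p))‖ ≤ √‖ψ‖ * ‖a‖ * √‖ψ (1 - p)‖ := by
    have h := norm_apply_star_mul_le hψ (star (p * a)) (1 - p)
    rw [hq, star_star] at h
    refine h.trans ?_
    gcongr
    calc √‖ψ (p * a * star (p * a))‖ ≤ √‖ψ‖ * ‖p * a‖ := by
          simpa only [star_star, norm_star] using
            sqrt_norm_apply_star_mul_self_le ψ (star (p * a))
      _ ≤ √‖ψ‖ * ‖a‖ := by
          gcongr
          exact (norm_mul_le p a).trans (mul_le_of_le_one_left (norm_nonneg a) hp.norm_le)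
  calc ‖ψ (p * a * p) - ψ a‖ = ‖ψ ((1 - p) * a) + ψ (p * a * (1 - p))‖ := by
        rw [← norm_neg, ← map_sub, ← map_neg, ← map_add]
        congr 2
        noncomm_ring
    _ ≤ 2 * (√‖ψ‖ * ‖a‖) * √‖ψ (1 - p)‖ := by
        linarith [norm_add_le (ψ ((1 - p) * a)) (ψ (p * a * (1 - p)))]

end PositiveFunctionals

section FiniteProjections

variable {H : Type*} [NormedAddCommGroup H] [InnerProductSpace ℂ H] {ι : Type*}

/-- The orthogonal projection `∑ i ∈ F, |eᵢ⟩⟨eᵢ|` onto the span of finitely many members of an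
orthonormal family `e`. -/
def finiteProjection (e : ι → H) (F : Finset ι) : H →L[ℂ] H :=
  ∑ i ∈ F, rankOne ℂ (e i) (e i)

theorem monotone_finiteProjection (e : ι → H) : Monotone (finiteProjection e) := by
  classical
  intro F G hFG
  rw [ContinuousLinearMap.le_def, finiteProjection, finiteProjection, ← Finset.sum_sdiff hFG,
    add_sub_cancel_right]
  exact ContinuousLinearMap.isPositive_sum _ fun _ _ => isPositive_rankOne_self _

theorem tendsto_finiteProjection_apply (b : HilbertBasis ι ℂ H) (v : H) :
    Tendsto (fun F => finiteProjection b F v) atTop (𝓝 v) := by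
  simpa [HasSum, finiteProjection, b.repr_apply_apply] using b.hasSum_repr v

theorem finiteProjection_mul_mul_finiteProjection (e : ι → H) (A : H →L[ℂ] H) (F : Finset ι) :
    finiteProjection e F * A * finiteProjection e F
      = ∑ i ∈ F, ∑ j ∈ F, ⟪e i, A (e j)⟫_ℂ • rankOne ℂ (e i) (e j) := by
  simp only [finiteProjection, Finset.sum_mul, Finset.mul_sum]
  rw [Finset.sum_comm]
  refine Finset.sum_congr rfl fun i _ => Finset.sum_congr rfl fun j _ => ?_
  rw [mul_assoc, ContinuousLinearMap.mul_def, ContinuousLinearMap.mul_def, comp_rankOne,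
    rankOne_comp_rankOne]

theorem isStarProjection_finiteProjection [CompleteSpace H] {e : ι → H} (he : Orthonormal ℂ e)
    (F : Finset ι) : IsStarProjection (finiteProjection e F) where
  isIdempotentElem := by
    classical
    simp [IsIdempotentElem, finiteProjection, Finset.sum_mul, Finset.mul_sum,
      ContinuousLinearMap.mul_def, rankOne_comp_rankOne, orthonormal_iff_ite.1 he]
  isSelfAdjoint :=
    (ContinuousLinearMap.isPositive_sum _ fun _ _ => isPositive_rankOne_self _).isSelfAdjoint

theorem sigmaWeakTendsto_finiteProjection [CompleteSpace H] (b : HilbertBasis ι ℂ H) :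
    SigmaWeakTendsto (finiteProjection b) atTop (1 : H →L[ℂ] H) := by
  refine sigmaWeakTendsto_iff.2 fun x y => ?_
  have hsum : Summable fun n => ‖x n‖ * ‖y n‖ :=
    lp.summable_mul (by simpa using Real.HolderConjugate.two_two) x y
  refine tendsto_tsum_of_dominated_convergence hsum (fun n => ?_)
    (Eventually.of_forall fun F n => ?_)
  · exact tendsto_const_nhds.inner (tendsto_finiteProjection_apply b (y n))
  · refine (norm_inner_le_norm _ _).trans ?_
    gcongr
    simpa using (finiteProjection b F).le_of_opNorm_le
      (isStarProjection_finiteProjection b.orthonormal F).norm_le (y n)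

end FiniteProjections

section Tight

variable {H : Type*} [NormedAddCommGroup H] [InnerProductSpace ℂ H] {ι : Type*}
  {b : HilbertBasis ι ℂ H} {ψ ψ' : (H →L[ℂ] H) →L[ℂ] ℂ}

/-- A functional on `B(H)` is tight with respect to a Hilbert basis if its value at `1` is the
limit of its values at the finite rank projections of the basis: no mass escapes to infinity. A
positive functional is σ-weakly continuous if and only if it is tight. -/
def IsTight (b : HilbertBasis ι ℂ H) (ψ : (H →L[ℂ] H) →L[ℂ] ℂ) : Prop :=
  Tendsto (fun F => ψ (finiteProjection b F)) atTop (𝓝 (ψ 1))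

variable [CompleteSpace H]

theorem isTight_predualCLM (b : HilbertBasis ι ℂ H) (x y : lp (fun _ : ℕ => H) 2) :
    IsTight b (predualCLM x y) :=
  sigmaWeakTendsto_iff.1 (sigmaWeakTendsto_finiteProjection b) x y

theorem IsNormalMap.isTight {φ : (H →L[ℂ] H) →L[ℂ] (H →L[ℂ] H)} (hφ : IsNormalMap φ)
    (b : HilbertBasis ι ℂ H) (x y : lp (fun _ : ℕ => H) 2) :
    IsTight b ((predualCLM x y).comp φ) := by
  let := sigmaWeak H
  exact (((continuous_predualFunctional x y).comp hφ).tendsto 1).comp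
    (sigmaWeakTendsto_finiteProjection b)

theorem isClosed_setOf_isTight (b : HilbertBasis ι ℂ H) : IsClosed {ψ | IsTight b ψ} := by
  have hlip (F : Finset ι) : LipschitzWith 1 fun ψ : (H →L[ℂ] H) →L[ℂ] ℂ =>
      ψ (finiteProjection b F) :=
    LipschitzWith.of_dist_le_mul fun ψ ψ' => by
      have hP := (isStarProjection_finiteProjection b.orthonormal F).norm_le
      simpa [dist_eq_norm] using (ψ - ψ').le_opNorm_of_le hP
  exact (LipschitzWith.uniformEquicontinuous _ 1 hlip).equicontinuous.isClosed_setOfPred_tendsto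
    (by fun_prop)

theorem IsTight.tendsto_compression (ht : IsTight b ψ) (hψ : ∀ A, 0 ≤ A → 0 ≤ ψ A)
    (A : H →L[ℂ] H) :
    Tendsto (fun F => ψ (finiteProjection b F * A * finiteProjection b F)) atTop (𝓝 (ψ A)) := by
  have hdefect : Tendsto (fun F => √‖ψ (1 - finiteProjection b F)‖) atTop (𝓝 0) := by
    simpa using (ht.const_sub (ψ 1)).norm.sqrt
  refine tendsto_iff_norm_sub_tendsto_zero.2 <| squeeze_zero (fun _ => norm_nonneg _)
    (fun F => norm_apply_compression_sub_le hψ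
      (isStarProjection_finiteProjection b.orthonormal F) A) ?_
  simpa using hdefect.const_mul (2 * (√‖ψ‖ * ‖A‖))

theorem IsTight.eq_of_forall_rankOne (ht : IsTight b ψ) (ht' : IsTight b ψ')
    (hψ : ∀ A, 0 ≤ A → 0 ≤ ψ A) (hψ' : ∀ A, 0 ≤ A → 0 ≤ ψ' A)
    (h : ∀ u v, ψ (rankOne ℂ u v) = ψ' (rankOne ℂ u v)) : ψ = ψ' := by
  refine ContinuousLinearMap.ext fun A => tendsto_nhds_unique (ht.tendsto_compression hψ A) ?_
  refine (ht'.tendsto_compression hψ' A).congr fun F => ?_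
  simp only [finiteProjection_mul_mul_finiteProjection, map_sum, map_smul, h]

theorem exists_isSelfAdjoint_inner_eq_apply_rankOne (hψ : ∀ A, 0 ≤ A → 0 ≤ ψ A) :
    ∃ S : H →L[ℂ] H, IsSelfAdjoint S ∧ ∀ v w, ⟪S v, S w⟫_ℂ = ψ (rankOne ℂ w v) := by
  let B : H →L⋆[ℂ] H →L[ℂ] ℂ := (ContinuousLinearMap.compL ℂ H (H →L[ℂ] H) ℂ ψ).comp
    (rankOne ℂ (E := H) (F := H)).flip
  let K := continuousLinearMapOfBilin B
  have hK (v w : H) : ⟪K v, w⟫_ℂ = ψ (rankOne ℂ w v) := continuousLinearMapOfBilin_apply B v w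
  have hK0 : 0 ≤ K := by
    rw [ContinuousLinearMap.nonneg_iff_isPositive, ContinuousLinearMap.isPositive_iff_complex]
    intro v
    have h0 : 0 ≤ ⟪K v, v⟫_ℂ := hK v v ▸ hψ _
      ((ContinuousLinearMap.nonneg_iff_isPositive _).2 (isPositive_rankOne_self v))
    exact ⟨(Complex.eq_re_of_ofReal_le h0).symm, (Complex.nonneg_iff.1 h0).1⟩
  have hS : IsSelfAdjoint (CFC.sqrt K) := (CFC.sqrt_nonneg K).isSelfAdjoint
  refine ⟨CFC.sqrt K, hS, fun v w => ?_⟩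
  rw [← hK, ← hS.isSymmetric.apply_clm, ← ContinuousLinearMap.comp_apply,
    ← ContinuousLinearMap.mul_def, CFC.sqrt_mul_sqrt_self K hK0]

theorem IsTight.exists_predualFunctional (ht : IsTight b ψ) (hψ : ∀ A, 0 ≤ A → 0 ≤ ψ A) :
    ∃ z : lp (fun _ : ℕ => H) 2, ∀ A, ψ A = predualFunctional z z A := by
  obtain ⟨S, hS, hSψ⟩ := exists_isSelfAdjoint_inner_eq_apply_rankOne hψ
  have hsum : Summable fun i => ‖S (b i)‖ ^ 2 := by
    refine ⟨(ψ 1).re, ((Complex.continuous_re.tendsto _).comp ht).congr fun F => ?_⟩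
    simp only [Function.comp, finiteProjection, map_sum, Complex.re_sum, ← hSψ]
    exact Finset.sum_congr rfl fun i _ => inner_self_eq_norm_sq (𝕜 := ℂ) _
  obtain ⟨z, hz⟩ := exists_predualFunctional_eq_tsum hsum
  have hrank (u v : H) : ψ (rankOne ℂ u v) = predualCLM z z (rankOne ℂ u v) := by
    rw [predualCLM_apply, hz, ← hSψ, ← b.tsum_inner_mul_inner]
    refine tsum_congr fun i => ?_
    rw [rankOne_apply, inner_smul_right, hS.isSymmetric.apply_clm, hS.isSymmetric.apply_clm]
  exact ⟨z, DFunLike.congr_fun <| ht.eq_of_forall_rankOne (isTight_predualCLM b z z) hψ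
    (fun _ => predualFunctional_nonneg z) hrank⟩

theorem isNormalMap_of_isTight {φ : (H →L[ℂ] H) →L[ℂ] (H →L[ℂ] H)}
    (hφ : ∀ A, 0 ≤ A → 0 ≤ φ A) (ht : ∀ x, IsTight b ((predualCLM x x).comp φ)) :
    IsNormalMap φ :=
  isNormalMap_of_forall_exists_diag fun x => (ht x).exists_predualFunctional
    fun _ hA => predualFunctional_nonneg x (hφ _ hA)

theorem IsNormalMap.exists_predualFunctional {φ : (H →L[ℂ] H) →L[ℂ] (H →L[ℂ] H)}
    (hφ : IsNormalMap φ) (hpos : ∀ A, 0 ≤ A → 0 ≤ φ A) (x : lp (fun _ : ℕ => H) 2) :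
    ∃ z : lp (fun _ : ℕ => H) 2, ∀ A, predualFunctional x x (φ A) = predualFunctional z z A := by
  obtain ⟨w, b, -⟩ := exists_hilbertBasis ℂ H
  exact (hφ.isTight b x x).exists_predualFunctional
    fun _ hA => predualFunctional_nonneg x (hpos _ hA)

end Tight

section OperatorMatrix

variable (H : Type*) [NormedAddCommGroup H] [InnerProductSpace ℂ H] [CompleteSpace H]
  (ι : Type*) [Fintype ι] [DecidableEq ι]

/-- The operator on the direct sum of copies of `H` which a matrix of operators on `H` represents,
`(M v) i = ∑ j, M i j (v j)`. It identifies the C⋆-algebra of matrices over `B(H)`, in terms of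
which complete positivity is defined, with an algebra of operators. -/
def operatorMatrixEquiv : CStarMatrix ι ι (H →L[ℂ] H) ≃⋆+*
    (PiLp 2 (fun _ : ι => H) →L[ℂ] PiLp 2 (fun _ : ι => H)) where
  toFun M := (PiLp.continuousLinearEquiv 2 ℂ fun _ : ι => H).symm.toContinuousLinearMap ∘L
    ContinuousLinearMap.pi fun i => ∑ j, M i j ∘L PiLp.proj 2 (fun _ : ι => H) j
  invFun T := fun i j => PiLp.proj 2 (fun _ : ι => H) i ∘L T ∘L
    (PiLp.continuousLinearEquiv 2 ℂ fun _ : ι => H).symm.toContinuousLinearMap ∘L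
      ContinuousLinearMap.single ℂ (fun _ : ι => H) j
  left_inv M := by
    ext i j v
    simp [apply_ite (M i _)]
  right_inv T := by
    ext v i
    have hv : ∑ j, PiLp.single 2 j (v j) = v := by
      ext k
      simp [WithLp.ofLp_sum, Pi.single_apply]
    conv_rhs => rw [← hv]
    simp
  map_add' M N := by
    ext v i
    simp [Finset.sum_add_distrib]
  map_mul' M N := by
    ext v i
    simp only [CStarMatrix.mul_apply, ContinuousLinearMap.comp_apply,
      ContinuousLinearMap.coe_pi', sum_apply, PiLp.proj_apply, mul_apply_eq_comp,
      ContinuousLinearEquiv.coe_coe, PiLp.continuousLinearEquiv_symm_apply, map_sum]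
    exact Finset.sum_comm
  map_star' M := by
    rw [ContinuousLinearMap.star_eq_adjoint, ContinuousLinearMap.eq_adjoint_iff]
    intro v w
    simp only [CStarMatrix.star_apply, ContinuousLinearMap.star_eq_adjoint,
      ContinuousLinearMap.comp_apply, ContinuousLinearMap.coe_pi', sum_apply, PiLp.proj_apply,
      ContinuousLinearEquiv.coe_coe, PiLp.continuousLinearEquiv_symm_apply, PiLp.inner_apply,
      sum_inner, ContinuousLinearMap.adjoint_inner_left, inner_sum]
    exact Finset.sum_comm

variable {H ι}

theorem operatorMatrixEquiv_apply (M : CStarMatrix ι ι (H →L[ℂ] H)) (v : PiLp 2 fun _ : ι => H)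
    (i : ι) : operatorMatrixEquiv H ι M v i = ∑ j, M i j (v j) := by
  change (∑ j, M i j ∘L PiLp.proj 2 (fun _ : ι => H) j) v = _
  simp

theorem inner_operatorMatrixEquiv_apply (M : CStarMatrix ι ι (H →L[ℂ] H))
    (v w : PiLp 2 fun _ : ι => H) :
    ⟪v, operatorMatrixEquiv H ι M w⟫_ℂ = ∑ i, ∑ j, ⟪v i, M i j (w j)⟫_ℂ := by
  simp only [PiLp.inner_apply, operatorMatrixEquiv_apply, inner_sum]

theorem nonneg_iff_forall_inner_nonneg {E : Type*} [NormedAddCommGroup E] [InnerProductSpace ℂ E]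
    [CompleteSpace E] {A : E →L[ℂ] E} : 0 ≤ A ↔ ∀ v, 0 ≤ ⟪v, A v⟫_ℂ := by
  rw [ContinuousLinearMap.nonneg_iff_isPositive]
  refine ⟨fun h v => h.inner_nonneg_right v, fun h => ?_⟩
  refine (ContinuousLinearMap.isPositive_iff_complex A).2 fun v => ?_
  have hv : 0 ≤ ⟪A v, v⟫_ℂ :=
    inner_conj_symm (𝕜 := ℂ) (A v) v ▸ star_nonneg_iff.2 (h v)
  exact ⟨(Complex.eq_re_of_ofReal_le hv).symm, (Complex.nonneg_iff.1 hv).1⟩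

theorem cstarMatrix_nonneg_iff {n : ℕ} {M : CStarMatrix (Fin n) (Fin n) (H →L[ℂ] H)} :
    0 ≤ M ↔ ∀ v : Fin n → H, 0 ≤ ∑ i, ∑ j, ⟪v i, M i j (v j)⟫_ℂ := by
  rw [← map_le_map_iff (operatorMatrixEquiv H (Fin n)), map_zero, nonneg_iff_forall_inner_nonneg,
    (WithLp.equiv 2 (Fin n → H)).forall_congr_left]
  simp only [inner_operatorMatrixEquiv_apply, WithLp.equiv_symm_apply]

end OperatorMatrix

section NormalMaps

variable {H : Type*} [NormedAddCommGroup H] [InnerProductSpace ℂ H]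
  {φ ψ : (H →L[ℂ] H) →L[ℂ] (H →L[ℂ] H)}

theorem isNormalMap_smul_one (c : ℂ) :
    IsNormalMap (c • (1 : (H →L[ℂ] H) →L[ℂ] (H →L[ℂ] H))) := by
  let := sigmaWeak H
  refine continuous_sigmaWeak_iff.2 fun x y => ?_
  simp only [smul_apply, one_apply_eq_self, predualFunctional_smul]
  exact (continuous_predualFunctional x y).const_mul c

theorem IsNormalMap.mul (hφ : IsNormalMap φ) (hψ : IsNormalMap ψ) : IsNormalMap (φ * ψ) :=
  @Continuous.comp _ _ _ (sigmaWeak H) (sigmaWeak H) (sigmaWeak H) ψ φ hφ hψ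

theorem IsNormalMap.add (hφ : IsNormalMap φ) (hψ : IsNormalMap ψ) : IsNormalMap (φ + ψ) := by
  let := sigmaWeak H
  refine continuous_sigmaWeak_iff.2 fun x y => ?_
  simp only [add_apply, predualFunctional_add]
  exact ((continuous_predualFunctional x y).comp hφ).add
    ((continuous_predualFunctional x y).comp hψ)

end NormalMaps

section CompletelyPositive

variable {H : Type*} [NormedAddCommGroup H] [InnerProductSpace ℂ H] [CompleteSpace H]
  {φ ψ : (H →L[ℂ] H) →L[ℂ] (H →L[ℂ] H)}

theorem isCompletelyPositive_iff_forall_sum_inner_nonneg :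
    IsCompletelyPositive φ ↔ ∀ (n : ℕ) (M : CStarMatrix (Fin n) (Fin n) (H →L[ℂ] H)), 0 ≤ M →
      ∀ v : Fin n → H, 0 ≤ ∑ i, ∑ j, ⟪v i, φ (M i j) (v j)⟫_ℂ := by
  simp only [IsCompletelyPositive, cstarMatrix_nonneg_iff, CStarMatrix.map_apply]

theorem IsCompletelyPositive.map_nonneg (hφ : IsCompletelyPositive φ) {A : H →L[ℂ] H}
    (hA : 0 ≤ A) : 0 ≤ φ A := by
  let M : CStarMatrix (Fin 1) (Fin 1) (H →L[ℂ] H) := fun _ _ => A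
  have hM : 0 ≤ M := cstarMatrix_nonneg_iff.2 fun v => by
    simpa using nonneg_iff_forall_inner_nonneg.1 hA (v 0)
  refine nonneg_iff_forall_inner_nonneg.2 fun v => ?_
  simpa using isCompletelyPositive_iff_forall_sum_inner_nonneg.1 hφ 1 _ hM fun _ => v

theorem IsCompletelyPositive.add (hφ : IsCompletelyPositive φ) (hψ : IsCompletelyPositive ψ) :
    IsCompletelyPositive (φ + ψ) :=
  fun n M hM => add_nonneg (hφ n M hM) (hψ n M hM)

theorem isCompletelyPositive_smul_one {c : ℂ} (hc : 0 ≤ c) :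
    IsCompletelyPositive (c • (1 : (H →L[ℂ] H) →L[ℂ] (H →L[ℂ] H))) := by
  refine isCompletelyPositive_iff_forall_sum_inner_nonneg.2 fun n M hM v => ?_
  simpa [inner_smul_right, ← Finset.mul_sum] using
    mul_nonneg hc (cstarMatrix_nonneg_iff.1 hM v)

/-- The normal completely positive maps on `B(H)`. They form a cone closed under composition, that
is, a subalgebra over the nonnegative reals. -/
def normalCompletelyPositive (H : Type*) [NormedAddCommGroup H] [InnerProductSpace ℂ H]
    [CompleteSpace H] : Subalgebra ℝ≥0 ((H →L[ℂ] H) →L[ℂ] (H →L[ℂ] H)) where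
  carrier := {φ | IsNormalMap φ ∧ IsCompletelyPositive φ}
  mul_mem' hφ hψ := ⟨hφ.1.mul hψ.1, fun n M hM => hφ.2 n _ (hψ.2 n M hM)⟩
  add_mem' hφ hψ := ⟨hφ.1.add hψ.1, hφ.2.add hψ.2⟩
  algebraMap_mem' r :=
    ⟨isNormalMap_smul_one ((r : ℝ) : ℂ), isCompletelyPositive_smul_one (by simp)⟩

theorem isClosed_setOf_isCompletelyPositive :
    IsClosed {φ : (H →L[ℂ] H) →L[ℂ] (H →L[ℂ] H) | IsCompletelyPositive φ} := by
  simp only [isCompletelyPositive_iff_forall_sum_inner_nonneg, Set.ofPred_forall]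
  refine isClosed_iInter fun n => isClosed_iInter fun M => isClosed_iInter fun _ =>
    isClosed_iInter fun v => isClosed_le continuous_const ?_
  fun_prop

theorem isClosed_normalCompletelyPositive :
    IsClosed (normalCompletelyPositive H : Set ((H →L[ℂ] H) →L[ℂ] (H →L[ℂ] H))) := by
  obtain ⟨w, b, -⟩ := exists_hilbertBasis ℂ H
  have htight : IsClosed {φ : (H →L[ℂ] H) →L[ℂ] (H →L[ℂ] H) |
      ∀ x : lp (fun _ : ℕ => H) 2, IsTight b ((predualCLM x x).comp φ)} := by
    simp only [Set.ofPred_forall]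
    exact isClosed_iInter fun x => (isClosed_setOf_isTight b).preimage (by fun_prop)
  convert isClosed_setOf_isCompletelyPositive.inter htight using 1
  ext φ
  exact ⟨fun h => ⟨h.2, fun x => h.1.isTight b x x⟩,
    fun h => ⟨isNormalMap_of_isTight (fun _ => h.1.map_nonneg) h.2, h.1⟩⟩

theorem exp_mem_of_isClosed {𝔸 : Type*} [NormedRing 𝔸] [NormedAlgebra ℝ 𝔸] [CompleteSpace 𝔸]
    {S : Subalgebra ℝ≥0 𝔸} (hS : IsClosed (S : Set 𝔸)) {a : 𝔸} (ha : a ∈ S) :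
    NormedSpace.exp a ∈ S := by
  refine hS.mem_of_tendsto (NormedSpace.exp_series_hasSum_exp' (𝕂 := ℝ) a)
    (Eventually.of_forall fun F => S.sum_mem fun n _ => ?_)
  exact S.smul_mem (S.pow_mem ha n) ((n.factorial : ℝ≥0)⁻¹)

end CompletelyPositive

section PositiveMaps

variable {𝔄 𝔅 : Type*} [CStarAlgebra 𝔄] [PartialOrder 𝔄] [StarOrderedRing 𝔄]
  [CStarAlgebra 𝔅] [PartialOrder 𝔅] [StarOrderedRing 𝔅]

theorem norm_positiveLinearMap_apply_le (φ : 𝔄 →ₚ[ℂ] 𝔅) (a : 𝔄) : ‖φ a‖ ≤ 4 * ‖φ 1‖ * ‖a‖ := by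
  obtain ⟨y, hy_nonneg, hy_norm, hy⟩ := CStarAlgebra.exists_sum_four_nonneg a
  calc ‖φ a‖ = ‖∑ i : Fin 4, Complex.I ^ (i : ℕ) • φ (y i)‖ := by
        conv_lhs => rw [hy, map_sum]
        simp only [map_smul]
    _ ≤ ∑ _i : Fin 4, ‖φ 1‖ * ‖a‖ := norm_sum_le_of_le _ fun i _ => by
        rw [norm_smul, norm_pow, Complex.norm_I, one_pow, one_mul]
        exact (φ.norm_apply_le_of_nonneg _ (hy_nonneg i)).trans (by gcongr; exact hy_norm i)
    _ = 4 * ‖φ 1‖ * ‖a‖ := by simp [mul_assoc]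

end PositiveMaps

section WeakIntegral

variable {H : Type*} [NormedAddCommGroup H] [InnerProductSpace ℂ H]
  {α : Type*} [MeasurableSpace α] {μ : Measure α} {f g : α → H →L[ℂ] H} {A B : H →L[ℂ] H} {C : ℝ}

/-- `A` is the weak integral `∫ f dμ` of the operator-valued function `f`, defined through its
matrix coefficients. -/
def HasWeakIntegral (f : α → H →L[ℂ] H) (μ : Measure α) (A : H →L[ℂ] H) : Prop :=
  ∀ v w, Integrable (fun t => ⟪v, f t w⟫_ℂ) μ ∧ ∫ t, ⟪v, f t w⟫_ℂ ∂μ = ⟪v, A w⟫_ℂ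

theorem HasWeakIntegral.unique (hA : HasWeakIntegral f μ A) (hB : HasWeakIntegral f μ B) :
    A = B :=
  ContinuousLinearMap.ext fun w => ext_inner_left ℂ fun v =>
    (hA v w).2.symm.trans (hB v w).2

theorem HasWeakIntegral.add (hf : HasWeakIntegral f μ A) (hg : HasWeakIntegral g μ B) :
    HasWeakIntegral (fun t => f t + g t) μ (A + B) := fun v w => by
  simp only [add_apply, inner_add_right, ← (hf v w).2, ← (hg v w).2]
  exact ⟨(hf v w).1.add (hg v w).1, integral_add (hf v w).1 (hg v w).1⟩

theorem HasWeakIntegral.smul (c : ℂ) (hf : HasWeakIntegral f μ A) :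
    HasWeakIntegral (fun t => c • f t) μ (c • A) := fun v w => by
  simp only [smul_apply, inner_smul_right, ← (hf v w).2]
  exact ⟨(hf v w).1.const_mul c, integral_const_mul _ _⟩

theorem hasWeakIntegral_const [IsProbabilityMeasure μ] (A : H →L[ℂ] H) :
    HasWeakIntegral (fun _ => A) μ A :=
  fun v w => ⟨integrable_const _, by simp⟩

theorem norm_inner_apply_le (A : H →L[ℂ] H) (v w : H) : ‖⟪v, A w⟫_ℂ‖ ≤ ‖A‖ * ‖v‖ * ‖w‖ :=
  calc ‖⟪v, A w⟫_ℂ‖ ≤ ‖v‖ * (‖A‖ * ‖w‖) :=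
        (norm_inner_le_norm _ _).trans (by gcongr; exact A.le_opNorm w)
    _ = ‖A‖ * ‖v‖ * ‖w‖ := by ring

theorem integral_sum_inner_eq {ι : Type*} [Fintype ι] {f : ι → ι → α → H →L[ℂ] H}
    {A : ι → ι → H →L[ℂ] H} (hf : ∀ i j, HasWeakIntegral (f i j) μ (A i j)) (v : ι → H) :
    ∫ t, ∑ i, ∑ j, ⟪v i, f i j t (v j)⟫_ℂ ∂μ = ∑ i, ∑ j, ⟪v i, A i j (v j)⟫_ℂ := by
  rw [integral_finsetSum _ fun i _ => integrable_finsetSum _ fun j _ => (hf i j _ _).1]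
  refine Finset.sum_congr rfl fun i _ => ?_
  rw [integral_finsetSum _ fun j _ => (hf i j _ _).1]
  exact Finset.sum_congr rfl fun j _ => (hf i j _ _).2

variable [IsFiniteMeasure μ]

theorem norm_integral_inner_apply_le (hC : ∀ t, ‖f t‖ ≤ C) (v w : H) :
    ‖∫ t, ⟪v, f t w⟫_ℂ ∂μ‖ ≤ C * μ.real Set.univ * ‖v‖ * ‖w‖ :=
  calc ‖∫ t, ⟪v, f t w⟫_ℂ ∂μ‖ ≤ C * ‖v‖ * ‖w‖ * μ.real Set.univ :=
        norm_integral_le_of_norm_le_const <| ae_of_all _ fun t =>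
          (norm_inner_apply_le _ v w).trans (by gcongr; exact hC t)
    _ = C * μ.real Set.univ * ‖v‖ * ‖w‖ := by ring

theorem HasWeakIntegral.norm_le (hf : HasWeakIntegral f μ A) (hC : ∀ t, ‖f t‖ ≤ C) (hC₀ : 0 ≤ C) :
    ‖A‖ ≤ C * μ.real Set.univ := by
  refine ContinuousLinearMap.opNorm_le_of_re_inner_le (by positivity) fun w v hw hv => ?_
  calc (⟪A w, v⟫_ℂ).re ≤ ‖⟪v, A w⟫_ℂ‖ := (Complex.re_le_norm _).trans_eq (norm_inner_symm _ _)
    _ ≤ C * μ.real Set.univ := by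
        simpa [← (hf v w).2, hv, hw] using norm_integral_inner_apply_le (μ := μ) hC v w

theorem exists_hasWeakIntegral [CompleteSpace H]
    (hf : ∀ v w, AEStronglyMeasurable (fun t => ⟪v, f t w⟫_ℂ) μ) (hC : ∀ t, ‖f t‖ ≤ C) :
    ∃ A, HasWeakIntegral f μ A := by
  have hf_int : ∀ v w, Integrable (fun t => ⟪v, f t w⟫_ℂ) μ := fun v w =>
    Integrable.of_bound (hf v w) (C * ‖v‖ * ‖w‖) <| ae_of_all _ fun t =>
      (norm_inner_apply_le _ v w).trans (by gcongr; exact hC t)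
  let form : H →ₗ⋆[ℂ] H →ₗ[ℂ] ℂ :=
    LinearMap.mk₂'ₛₗ (starRingEnd ℂ) (RingHom.id ℂ) (fun v w => ∫ t, ⟪v, f t w⟫_ℂ ∂μ)
      (fun v v' w => by
        simp only [inner_add_left]
        exact integral_add (hf_int v w) (hf_int v' w))
      (fun c v w => by
        simp only [inner_smul_left]
        exact integral_const_mul _ _)
      (fun v w w' => by
        simp only [_root_.map_add, inner_add_right]
        exact integral_add (hf_int v w) (hf_int v w'))
      (fun c v w => by
        simp only [_root_.map_smul, inner_smul_right]
        exact integral_const_mul _ _)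
  let boundedForm : H →L⋆[ℂ] H →L[ℂ] ℂ :=
    form.mkContinuous₂ (C * μ.real Set.univ) (norm_integral_inner_apply_le hC)
  refine ⟨(continuousLinearMapOfBilin boundedForm).adjoint, fun v w => ⟨hf_int v w, ?_⟩⟩
  rw [ContinuousLinearMap.adjoint_inner_right, continuousLinearMapOfBilin_apply]
  rfl

theorem HasWeakIntegral.integral_predualFunctional (hf : HasWeakIntegral f μ A)
    (hC : ∀ t, ‖f t‖ ≤ C) (x y : lp (fun _ : ℕ => H) 2) :
    ∫ t, predualFunctional x y (f t) ∂μ = predualFunctional x y A := by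
  have hsum : Summable fun n => C * (‖x n‖ * ‖y n‖) * μ.real Set.univ :=
    ((lp.summable_mul (by simpa using Real.HolderConjugate.two_two) x y).mul_left C).mul_right _
  simp only [predualFunctional, ← (hf _ _).2]
  refine (integral_tsum_of_summable_integral_norm (fun n => (hf _ _).1)
    (hsum.of_nonneg_of_le
      (fun n => integral_nonneg fun _ => norm_nonneg _) fun n => ?_)).symm
  calc ∫ t, ‖⟪x n, f t (y n)⟫_ℂ‖ ∂μ ≤ ∫ _, C * (‖x n‖ * ‖y n‖) ∂μ :=
        integral_mono (hf _ _).1.norm (integrable_const _) fun t =>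
          (norm_inner_apply_le _ _ _).trans (by rw [mul_assoc]; gcongr; exact hC t)
    _ = C * (‖x n‖ * ‖y n‖) * μ.real Set.univ := by simp [mul_comm]

end WeakIntegral

section TightMeasure

variable {α ι : Type*} [MeasurableSpace α] {μ : Measure α} [IsFiniteMeasure μ] {C : ℝ}

theorem integral_le_of_le_of_le_compl {g : α → ℝ} {K : Set α} {δ : ℝ} (hg : Integrable g μ)
    (hK : MeasurableSet K) (hgK : ∀ t ∈ K, g t ≤ δ) (hgKc : ∀ t ∈ Kᶜ, g t ≤ C) :
    ∫ t, g t ∂μ ≤ δ * μ.real K + C * μ.real Kᶜ := by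
  have h : ∀ {s : Set α} {c : ℝ}, MeasurableSet s → (∀ t ∈ s, g t ≤ c) →
      ∫ t in s, g t ∂μ ≤ c * μ.real s := fun {s c} hs hgs =>
    (setIntegral_mono_on hg.integrableOn (integrable_const c) hs hgs).trans_eq <| by
      rw [setIntegral_const, smul_eq_mul, mul_comm]
  rw [← integral_add_compl hK hg]
  exact add_le_add (h hK hgK) (h hK.compl hgKc)

variable [TopologicalSpace α] [T2Space α] [BorelSpace α] [Preorder ι]
  [IsDirectedOrder ι]

/-- The net need not be countable, which is why dominated convergence does not apply. -/
theorem tendsto_integral_zero_of_antitone (hμ : IsTightMeasureSet {μ}) {g : ι → α → ℝ}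
    (hg_cont : ∀ i, Continuous (g i)) (hg : Antitone g)
    (hg_lim : ∀ t, Tendsto (g · t) atTop (𝓝 0)) (hC : ∀ i t, g i t ≤ C) :
    Tendsto (fun i => ∫ t, g i t ∂μ) atTop (𝓝 0) := by
  have hg_nonneg : ∀ i t, 0 ≤ g i t := fun i t =>
    Antitone.le_of_tendsto (fun _ _ h => hg h t) (hg_lim t) i
  refine tendsto_order.2 ⟨fun a ha => Eventually.of_forall fun i =>
    ha.trans_le (integral_nonneg (hg_nonneg i)), fun a ha => ?_⟩
  set m := μ.real Set.univ
  set C' := max C 0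
  have hm : 0 ≤ m := measureReal_nonneg
  have hC' : 0 ≤ C' := le_max_right C 0
  obtain ⟨δ, hδ, hδa⟩ : ∃ δ : ℝ, 0 < δ ∧ δ * m + C' * δ < a :=
    ⟨a / (m + C' + 1), by positivity, by
      field_simp
      exact lt_add_one _⟩
  obtain ⟨K, hK, hKμ⟩ := isTightMeasureSet_iff_exists_isCompact_measure_compl_le.1 hμ
    (ENNReal.ofReal δ) (ENNReal.ofReal_pos.2 hδ)
  have hK_real : μ.real Kᶜ ≤ δ := ENNReal.toReal_le_of_le_ofReal hδ.le (hKμ μ rfl)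
  have hunif := Antitone.tendstoUniformlyOn_of_forall_tendsto hK (fun i => (hg_cont i).continuousOn)
    (fun t _ _ _ h => hg h t) (continuousOn_const (c := (0 : ℝ))) fun t _ => hg_lim t
  filter_upwards [Metric.tendstoUniformlyOn_iff.1 hunif δ hδ] with i hi
  have hg_int : Integrable (g i) μ :=
    Integrable.of_bound (hg_cont i).aestronglyMeasurable C <| ae_of_all _ fun t =>
      (Real.norm_of_nonneg (hg_nonneg i t)).trans_le (hC i t)
  calc ∫ t, g i t ∂μ ≤ δ * μ.real K + C' * μ.real Kᶜ :=
        integral_le_of_le_of_le_compl hg_int hK.measurableSet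
          (fun t ht => (le_abs_self _).trans <| by simpa [Real.dist_eq] using (hi t ht).le)
          fun t _ => (hC i t).trans (le_max_left C 0)
    _ ≤ δ * m + C' * δ := by gcongr; exact measureReal_mono (Set.subset_univ K)
    _ < a := hδa

end TightMeasure

section AverageOfMaps

variable {H : Type*} [NormedAddCommGroup H] [InnerProductSpace ℂ H] [CompleteSpace H]
  {α : Type*} [MeasurableSpace α] {μ : Measure α}
  {Φ : α → (H →L[ℂ] H) →L[ℂ] (H →L[ℂ] H)} {E : (H →L[ℂ] H) →L[ℂ] (H →L[ℂ] H)} {C : ℝ}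

theorem HasWeakIntegral.nonneg {f : α → H →L[ℂ] H} {A : H →L[ℂ] H} (hf : HasWeakIntegral f μ A)
    (hf_nonneg : ∀ t, 0 ≤ f t) : 0 ≤ A :=
  nonneg_iff_forall_inner_nonneg.2 fun v => (hf v v).2 ▸ integral_nonneg fun t =>
    nonneg_iff_forall_inner_nonneg.1 (hf_nonneg t) v

theorem exists_forall_hasWeakIntegral [IsFiniteMeasure μ]
    (hΦ : ∀ A v w, AEStronglyMeasurable (fun t => ⟪v, Φ t A w⟫_ℂ) μ) (hC : ∀ t, ‖Φ t‖ ≤ C)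
    (hC₀ : 0 ≤ C) :
    ∃ E : (H →L[ℂ] H) →L[ℂ] (H →L[ℂ] H), ∀ A, HasWeakIntegral (fun t => Φ t A) μ (E A) := by
  have hbound (A : H →L[ℂ] H) (t : α) : ‖Φ t A‖ ≤ C * ‖A‖ := (Φ t).le_of_opNorm_le (hC t) A
  choose E hE using fun A => exists_hasWeakIntegral (hΦ A) (hbound A)
  let Elin : (H →L[ℂ] H) →ₗ[ℂ] (H →L[ℂ] H) :=
    { toFun := E
      map_add' := fun A B => (hE (A + B)).unique <| by
        simpa only [_root_.map_add] using (hE A).add (hE B)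
      map_smul' := fun c A => (hE (c • A)).unique <| by
        simpa only [_root_.map_smul, RingHom.id_apply] using (hE A).smul c }
  refine ⟨Elin.mkContinuous (C * μ.real Set.univ) fun A => ?_, hE⟩
  exact ((hE A).norm_le (hbound A) (by positivity)).trans_eq (by ring)

theorem isCompletelyPositive_of_hasWeakIntegral
    (hE : ∀ A, HasWeakIntegral (fun t => Φ t A) μ (E A)) (hΦ : ∀ t, IsCompletelyPositive (Φ t)) :
    IsCompletelyPositive E := by
  refine isCompletelyPositive_iff_forall_sum_inner_nonneg.2 fun n M hM v => ?_
  rw [← integral_sum_inner_eq (fun i j => hE (M i j)) v]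
  exact integral_nonneg fun t =>
    isCompletelyPositive_iff_forall_sum_inner_nonneg.1 (hΦ t) n M hM v

variable [IsFiniteMeasure μ] [TopologicalSpace α] [T2Space α] [BorelSpace α]

theorem isTight_of_forall_eq_integral {ι : Type*} {b : HilbertBasis ι ℂ H}
    {ψ : (H →L[ℂ] H) →L[ℂ] ℂ} {Ψ : α → (H →L[ℂ] H) →L[ℂ] ℂ} (hμ : IsTightMeasureSet {μ})
    (hψ : ∀ A, ψ A = ∫ t, Ψ t A ∂μ) (hΨ_tight : ∀ t, IsTight b (Ψ t))
    (hΨ_nonneg : ∀ t A, 0 ≤ A → 0 ≤ Ψ t A) (hΨ_cont : ∀ A, Continuous fun t => Ψ t A)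
    (hC : ∀ t, ‖Ψ t‖ ≤ C) : IsTight b ψ := by
  let Q (F : Finset ι) : H →L[ℂ] H := 1 - finiteProjection b F
  have hQ (F) : IsStarProjection (Q F) :=
    (isStarProjection_finiteProjection b.orthonormal F).one_sub
  let mass (F : Finset ι) (t : α) : ℝ := (Ψ t (Q F)).re
  have hmass_cont (F) : Continuous (mass F) := Complex.continuous_re.comp (hΨ_cont (Q F))
  have hmass_anti : Antitone mass := fun F G hFG t =>
    Complex.re_le_re <| sub_nonneg.1 <| by
      rw [← map_sub]
      exact hΨ_nonneg t _ (sub_nonneg.2 (sub_le_sub_left (monotone_finiteProjection b hFG) 1))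
  have hmass_lim (t) : Tendsto (mass · t) atTop (𝓝 0) := by
    simpa [mass, Q, Function.comp_def] using
      (Complex.continuous_re.tendsto _).comp ((hΨ_tight t).const_sub (Ψ t 1))
  have hmass_le (F t) : mass F t ≤ C :=
    (Complex.re_le_norm _).trans (by simpa using (Ψ t).le_of_opNorm_le_of_le (hC t) (hQ F).norm_le)
  have hmass_eq (F) : ((∫ t, mass F t ∂μ : ℝ) : ℂ) = ψ (Q F) := by
    rw [hψ, ← integral_complex_ofReal]
    exact integral_congr_ae <| ae_of_all _ fun t =>
      (Complex.eq_re_of_ofReal_le (hΨ_nonneg t _ (hQ F).nonneg)).symm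
  have hlim : Tendsto (fun F => ∫ t, mass F t ∂μ) atTop (𝓝 0) :=
    tendsto_integral_zero_of_antitone hμ hmass_cont hmass_anti hmass_lim hmass_le
  have hψQ : Tendsto (fun F => ψ (Q F)) atTop (𝓝 0) := by
    simpa only [Function.comp_def, hmass_eq, Complex.ofReal_zero] using
      (Complex.continuous_ofReal.tendsto 0).comp hlim
  simpa [IsTight, Q] using hψQ.const_sub (ψ 1)

theorem isNormalMap_of_hasWeakIntegral (hμ : IsTightMeasureSet {μ})
    (hE : ∀ A, HasWeakIntegral (fun t => Φ t A) μ (E A)) (hΦ_normal : ∀ t, IsNormalMap (Φ t))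
    (hΦ_nonneg : ∀ t A, 0 ≤ A → 0 ≤ Φ t A)
    (hΦ_cont : ∀ A, Continuous[inferInstance, sigmaWeak H] fun t => Φ t A)
    (hC : ∀ t, ‖Φ t‖ ≤ C) : IsNormalMap E := by
  obtain ⟨w, b, -⟩ := exists_hilbertBasis ℂ H
  refine isNormalMap_of_isTight (b := b) (fun A hA => (hE A).nonneg fun t => hΦ_nonneg t A hA)
    fun x => ?_
  refine isTight_of_forall_eq_integral (Ψ := fun t => (predualCLM x x).comp (Φ t)) hμ
    (fun A => ?_) (fun t => (hΦ_normal t).isTight b x x)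
    (fun t A hA => predualFunctional_nonneg x (hΦ_nonneg t A hA))
    (fun A => continuous_sigmaWeak_iff.1 (hΦ_cont A) x x)
    (fun t => (ContinuousLinearMap.opNorm_comp_le _ _).trans
      (mul_le_mul_of_nonneg_left (hC t) (norm_nonneg _)))
  exact ((hE A).integral_predualFunctional (fun t => (Φ t).le_of_opNorm_le (hC t) A) x x).symm

end AverageOfMaps

theorem tendsto_nnreal_slope_of_hasDerivAt {E : Type*} [NormedAddCommGroup E] [NormedSpace ℂ E]
    {F : ℝ → E} {F' : E} (hF : HasDerivAt F F' 0) :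
    Tendsto (fun t : ℝ≥0 => ((t : ℝ) : ℂ)⁻¹ • (F t - F 0)) (𝓝[>] 0) (𝓝 F') := by
  have hcoe : Tendsto ((↑) : ℝ≥0 → ℝ) (𝓝[>] 0) (𝓝[>] 0) :=
    tendsto_nhdsWithin_iff.2 ⟨(NNReal.continuous_coe.tendsto 0).mono_left nhdsWithin_le_nhds,
      eventually_mem_nhdsWithin⟩
  refine (hF.tendsto_slope_zero_right.comp hcoe).congr fun t => ?_
  simp only [Function.comp_apply, zero_add, ← Complex.ofReal_inv, Complex.coe_smul]

section ExponentialLaw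

open ProbabilityTheory (expMeasure)

/-- The law of `ε X`, where `X` is a standard exponential random variable. It lives on `ℝ≥0`, the
time axis of the semigroups, and is the Dirac mass at `0` when `ε ≤ 0`. -/
def expLaw (ε : ℝ) : Measure ℝ≥0 :=
  (expMeasure 1).map fun s => (ε * s).toNNReal

instance : IsProbabilityMeasure (expMeasure 1) :=
  ProbabilityTheory.isProbabilityMeasure_expMeasure one_pos

instance (ε : ℝ) : IsProbabilityMeasure (expLaw ε) :=
  Measure.isProbabilityMeasure_map (by fun_prop)

variable {E : Type*} [NormedAddCommGroup E] [NormedSpace ℝ E]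

theorem integral_expMeasure_one (g : ℝ → E) :
    ∫ s, g s ∂expMeasure 1 = ∫ s in Set.Ioi (0 : ℝ), Real.exp (-s) • g s := by
  have hpdf : Measurable (ProbabilityTheory.exponentialPDF 1) := by
    unfold ProbabilityTheory.exponentialPDF
    fun_prop
  change ∫ s, g s ∂volume.withDensity (ProbabilityTheory.exponentialPDF 1) = _
  rw [integral_withDensity_eq_integral_toReal_smul hpdf
      (ae_of_all _ fun _ => ENNReal.ofReal_lt_top),
    ← integral_Ici_eq_integral_Ioi, ← integral_indicator measurableSet_Ici]
  refine integral_congr_ae (ae_of_all _ fun s => ?_)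
  by_cases hs : 0 ≤ s
  · simp [ProbabilityTheory.exponentialPDF_of_nonneg, hs, (Real.exp_pos _).le]
  · simp [ProbabilityTheory.exponentialPDF_of_neg (not_le.1 hs), hs]

theorem integral_expLaw (ε : ℝ) {f : ℝ≥0 → E} (hf : Continuous f) :
    ∫ t, f t ∂expLaw ε = ∫ s, f (ε * s).toNNReal ∂expMeasure 1 :=
  integral_map (by fun_prop) hf.aestronglyMeasurable

variable {f : ℝ≥0 → E} {C : ℝ}

theorem tendsto_integral_expLaw [CompleteSpace E] (hf : Continuous f) (hC : ∀ t, ‖f t‖ ≤ C) :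
    Tendsto (fun ε => ∫ t, f t ∂expLaw ε) (𝓝 0) (𝓝 (f 0)) := by
  simp_rw [integral_expLaw _ hf]
  have hconst : ∫ _, f 0 ∂expMeasure 1 = f 0 := by simp
  rw [← hconst]
  refine tendsto_integral_filter_of_dominated_convergence (fun _ => C)
    (Eventually.of_forall fun ε => by fun_prop)
    (Eventually.of_forall fun ε => ae_of_all _ fun s => hC _) (integrable_const C)
    (ae_of_all _ fun s => ?_)
  have : Continuous fun ε : ℝ => f (ε * s).toNNReal := by fun_prop
  simpa using this.tendsto 0

theorem integrableOn_exp_neg_smul {g : ℝ → E} (hg : Continuous g) (hC : ∀ s, ‖g s‖ ≤ C) (a : ℝ) :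
    IntegrableOn (fun s => Real.exp (-s) • g s) (Set.Ioi a) :=
  (integrableOn_exp_neg_Ioi a).smul_bdd C hg.aestronglyMeasurable (ae_of_all _ hC)

-- The exponential law is memoryless.
theorem integral_expLaw_comp_add_left {ε : ℝ} (hε : 0 < ε) (hf : Continuous f) (h : ℝ≥0) :
    ∫ t, f (h + t) ∂expLaw ε = Real.exp (h / ε) •
      ∫ u in Set.Ioi (h / ε : ℝ), Real.exp (-u) • f (ε * u).toNNReal := by
  rw [integral_expLaw ε (by fun_prop), integral_expMeasure_one, ← integral_smul]
  have hshift := (measurePreserving_add_right volume (h / ε : ℝ)).setIntegral_preimage_emb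
    (measurableEmbedding_addRight _)
    (fun u => Real.exp (h / ε) • Real.exp (-u) • f (ε * u).toNNReal) (Set.Ioi (h / ε : ℝ))
  rw [← hshift, Set.preimage_add_const_Ioi, sub_self]
  refine setIntegral_congr_fun measurableSet_Ioi fun s hs => ?_
  have hs0 : 0 ≤ ε * s := mul_nonneg hε.le (Set.mem_Ioi.1 hs).le
  have htime : (ε * (s + h / ε)).toNNReal = h + (ε * s).toNNReal := by
    rw [mul_add, mul_div_cancel₀ _ hε.ne', add_comm (ε * s), Real.toNNReal_add h.coe_nonneg hs0,
      Real.toNNReal_coe]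
  have hweight : Real.exp (h / ε) * Real.exp (-(s + h / ε)) = Real.exp (-s) := by
    rw [← Real.exp_add]
    ring_nf
  simp only [htime, smul_smul, hweight]

theorem hasDerivAt_integral_Ioi [CompleteSpace E] {g : ℝ → E} (hg : Continuous g) (a : ℝ)
    (hg_int : IntegrableOn g (Set.Ioi a)) :
    HasDerivAt (fun b => ∫ u in Set.Ioi b, g u) (-g a) a := by
  have hsplit (b : ℝ) : ∫ u in Set.Ioi b, g u = (∫ u in Set.Ioi a, g u) - ∫ u in a..b, g u := by
    have hb : IntegrableOn g (Set.Ioi b) :=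
      (hg.integrableOn_Ioc.union hg_int).mono_set Set.Ioi_subset_Ioc_union_Ioi
    rw [← intervalIntegral.integral_interval_add_Ioi hg_int hb, add_sub_cancel_left]
  rw [funext hsplit]
  exact (hg.integral_hasStrictDerivAt a a).hasDerivAt.const_sub _

theorem hasDerivAt_integral_expLaw_comp_add_left [CompleteSpace E] {ε : ℝ} (hf : Continuous f)
    (hC : ∀ t, ‖f t‖ ≤ C) :
    HasDerivAt (fun h : ℝ => Real.exp (h / ε) •
        ∫ u in Set.Ioi (h / ε), Real.exp (-u) • f (ε * u).toNNReal)
      (ε⁻¹ • (∫ t, f t ∂expLaw ε - f 0)) 0 := by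
  set g : ℝ → E := fun u => Real.exp (-u) • f (ε * u).toNNReal with hg
  have hscale : HasDerivAt (fun h : ℝ => h / ε) ε⁻¹ 0 := by
    simpa using (hasDerivAt_id (0 : ℝ)).div_const ε
  have htail : HasDerivAt (fun b => ∫ u in Set.Ioi b, g u) (-g (0 / ε)) (0 / ε) :=
    hasDerivAt_integral_Ioi (by fun_prop) _
      (integrableOn_exp_neg_smul (by fun_prop) (fun _ => hC _) _)
  refine (hscale.exp.smul (htail.scomp 0 hscale)).congr_deriv ?_
  rw [integral_expLaw ε hf, integral_expMeasure_one]
  simp [hg, sub_eq_neg_add]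

theorem tendsto_slope_integral_expLaw {E : Type*} [NormedAddCommGroup E] [NormedSpace ℂ E]
    [CompleteSpace E] {f : ℝ≥0 → E} {ε : ℝ} (hε : 0 < ε) (hf : Continuous f)
    (hC : ∀ t, ‖f t‖ ≤ C) :
    Tendsto (fun h : ℝ≥0 => ((h : ℝ) : ℂ)⁻¹ • (∫ t, f (h + t) ∂expLaw ε - ∫ t, f t ∂expLaw ε))
      (𝓝[>] 0) (𝓝 ((ε : ℂ)⁻¹ • (∫ t, f t ∂expLaw ε - f 0))) := by
  have h := tendsto_nnreal_slope_of_hasDerivAt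
    (hasDerivAt_integral_expLaw_comp_add_left (ε := ε) hf hC)
  have h0 := integral_expLaw_comp_add_left hε hf 0
  simp only [NNReal.coe_zero, zero_add] at h0
  simpa only [← integral_expLaw_comp_add_left hε hf, ← h0, ← Complex.ofReal_inv,
    Complex.coe_smul] using h

end ExponentialLaw

section RightInverse

variable {E : Type*} [NormedAddCommGroup E] [NormedSpace ℂ E] {L : E →ₗ.[ℂ] E} {ε : ℝ}
  {R : E →L[ℂ] E}

theorem isResolventComposite_of_inverse (hε : ε ≠ 0)
    (hLR : ∀ A, ∃ h : R A ∈ L.domain, L ⟨R A, h⟩ = (ε : ℂ)⁻¹ • (R A - A))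
    (hRL : ∀ A : L.domain, R (L A) = (ε : ℂ)⁻¹ • (R A - A)) :
    IsResolventComposite L ε ((ε : ℂ)⁻¹ • (R - 1)) := by
  have hε' : (ε : ℂ) ≠ 0 := Complex.ofReal_ne_zero.2 hε
  choose hdom hLR using hLR
  have hright (A : E) : (L.domain.subtype - (ε : ℂ) • L.toFun) ⟨R A, hdom A⟩ = A := by
    change R A - (ε : ℂ) • L ⟨R A, hdom A⟩ = A
    rw [hLR, smul_inv_smul₀ hε', sub_sub_cancel]
  have hleft (A : L.domain) : R ((L.domain.subtype - (ε : ℂ) • L.toFun) A) = A := by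
    change R (A - (ε : ℂ) • L A) = A
    rw [map_sub, map_smul, hRL, smul_inv_smul₀ hε', sub_sub_cancel]
  have hbij : Function.Bijective (L.domain.subtype - (ε : ℂ) • L.toFun) :=
    ⟨fun A B hAB => Subtype.ext ((hleft A).symm.trans (hAB ▸ hleft B)), fun A => ⟨_, hright A⟩⟩
  refine ⟨hbij, fun A => ?_⟩
  rw [(LinearEquiv.symm_apply_eq (.ofBijective _ hbij)).2 (hright A).symm, hLR]
  rfl

end RightInverse

section Resolvent

namespace QuantumDynamicalSemigroup

variable {H : Type*} [NormedAddCommGroup H] [InnerProductSpace ℂ H] [CompleteSpace H]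
  {S : QuantumDynamicalSemigroup H} {A B : H →L[ℂ] H} {ε : ℝ}

theorem GeneratesAt.mem_domain (h : S.GeneratesAt A B) : A ∈ S.generator.domain := ⟨B, h⟩

theorem GeneratesAt.generator_eq (h : S.GeneratesAt A B) : S.generator ⟨A, h.mem_domain⟩ = B :=
  (S.generator_spec _).unique h

theorem GeneratesAt.apply_of_commute (h : S.GeneratesAt A B)
    {φ : (H →L[ℂ] H) →L[ℂ] (H →L[ℂ] H)} (hφ : IsNormalMap φ)
    (hcomm : ∀ t C, φ (S.T t C) = S.T t (φ C)) : S.GeneratesAt (φ A) (φ B) := by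
  have hlim : SigmaWeakTendsto (fun t : ℝ≥0 => φ (((t : ℝ) : ℂ)⁻¹ • (S.T t A - A))) (𝓝[>] 0)
      (φ B) :=
    (@Continuous.tendsto _ _ (sigmaWeak H) (sigmaWeak H) φ hφ B).comp h
  refine hlim.congr fun t => ?_
  rw [_root_.map_smul, _root_.map_sub, hcomm]

theorem continuous_predualFunctional_apply (x y : lp (fun _ : ℕ => H) 2) (A : H →L[ℂ] H) :
    Continuous fun t => predualFunctional x y (S.T t A) :=
  continuous_sigmaWeak_iff.1 (S.sigmaWeak_continuous A) x y

theorem continuous_inner_apply (v w : H) (A : H →L[ℂ] H) :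
    Continuous fun t => ⟪v, S.T t A w⟫_ℂ := by
  simpa only [predualFunctional_single] using
    S.continuous_predualFunctional_apply (lp.single 2 0 v) (lp.single 2 0 w) A

namespace IsMarkov

variable (hS : S.IsMarkov)
include hS

theorem norm_le (t : ℝ≥0) : ‖S.T t‖ ≤ 4 := by
  refine ContinuousLinearMap.opNorm_le_bound _ (by norm_num) fun A => ?_
  have h := norm_positiveLinearMap_apply_le
    (.mk₀ (S.T t).toLinearMap fun B hB => (S.completelyPositive t).map_nonneg hB) A
  have h1 : ‖S.T t 1‖ ≤ 1 := (hS t).symm ▸ ContinuousLinearMap.norm_id_le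
  refine h.trans ?_
  gcongr
  change 4 * ‖S.T t 1‖ ≤ 4
  linarith

theorem norm_predualFunctional_apply_le (x y : lp (fun _ : ℕ => H) 2) (A : H →L[ℂ] H) (t : ℝ≥0) :
    ‖predualFunctional x y (S.T t A)‖ ≤ ‖x‖ * ‖y‖ * (4 * ‖A‖) := by
  refine (norm_predualFunctional_le x y _).trans ?_
  gcongr
  exact (S.T t).le_of_opNorm_le (hS.norm_le t) A

theorem exists_forall_hasWeakIntegral_expLaw (ε : ℝ) :
    ∃ R : (H →L[ℂ] H) →L[ℂ] (H →L[ℂ] H),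
      ∀ A, HasWeakIntegral (fun t => S.T t A) (expLaw ε) (R A) :=
  exists_forall_hasWeakIntegral
    (fun A v w => (S.continuous_inner_apply v w A).aestronglyMeasurable) hS.norm_le (by norm_num)

/-- The resolvent `(1 - ε L)⁻¹` of the generator `L` of a quantum Markov semigroup, as the Laplace
transform `∫₀^∞ e⁻ˢ T (ε s) ds`. -/
def resolvent (ε : ℝ) : (H →L[ℂ] H) →L[ℂ] (H →L[ℂ] H) :=
  (hS.exists_forall_hasWeakIntegral_expLaw ε).choose

theorem hasWeakIntegral_resolvent (ε : ℝ) (A : H →L[ℂ] H) :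
    HasWeakIntegral (fun t => S.T t A) (expLaw ε) (hS.resolvent ε A) :=
  (hS.exists_forall_hasWeakIntegral_expLaw ε).choose_spec A

theorem predualFunctional_resolvent (ε : ℝ) (x y : lp (fun _ : ℕ => H) 2) (A : H →L[ℂ] H) :
    predualFunctional x y (hS.resolvent ε A) = ∫ t, predualFunctional x y (S.T t A) ∂expLaw ε :=
  ((hS.hasWeakIntegral_resolvent ε A).integral_predualFunctional
    (fun t => (S.T t).le_of_opNorm_le (hS.norm_le t) A) x y).symm

theorem resolvent_one (ε : ℝ) : hS.resolvent ε 1 = 1 := by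
  refine (hS.hasWeakIntegral_resolvent ε 1).unique ?_
  simp only [hS _]
  exact hasWeakIntegral_const 1

theorem isNormalMap_resolvent (ε : ℝ) : IsNormalMap (hS.resolvent ε) :=
  isNormalMap_of_hasWeakIntegral isTightMeasureSet_singleton (hS.hasWeakIntegral_resolvent ε)
    S.normal (fun t _ => (S.completelyPositive t).map_nonneg) S.sigmaWeak_continuous hS.norm_le

theorem isCompletelyPositive_resolvent (ε : ℝ) : IsCompletelyPositive (hS.resolvent ε) :=
  isCompletelyPositive_of_hasWeakIntegral (hS.hasWeakIntegral_resolvent ε) S.completelyPositive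

theorem predualFunctional_apply_resolvent (h : ℝ≥0) (x : lp (fun _ : ℕ => H) 2)
    (A : H →L[ℂ] H) :
    predualFunctional x x (S.T h (hS.resolvent ε A))
      = ∫ t, predualFunctional x x (S.T (h + t) A) ∂expLaw ε := by
  obtain ⟨z, hz⟩ := (S.normal h).exists_predualFunctional
    (fun _ => (S.completelyPositive h).map_nonneg) x
  simp_rw [S.map_add, hz]
  exact hS.predualFunctional_resolvent ε z z A

theorem resolvent_apply (t : ℝ≥0) (A : H →L[ℂ] H) :
    hS.resolvent ε (S.T t A) = S.T t (hS.resolvent ε A) := by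
  refine ext_predualFunctional fun x => ?_
  rw [hS.predualFunctional_resolvent, hS.predualFunctional_apply_resolvent]
  simp_rw [← S.map_add, add_comm]

theorem generatesAt_resolvent (hε : 0 < ε) (A : H →L[ℂ] H) :
    S.GeneratesAt (hS.resolvent ε A) ((ε : ℂ)⁻¹ • (hS.resolvent ε A - A)) := by
  refine sigmaWeakTendsto_iff_diag.2 fun x => ?_
  have h := tendsto_slope_integral_expLaw hε (S.continuous_predualFunctional_apply x x A)
    (hS.norm_predualFunctional_apply_le x x A)
  simp only [← hS.predualFunctional_apply_resolvent, ← hS.predualFunctional_resolvent,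
    S.map_zero] at h
  simpa only [← predualCLM_apply, _root_.map_smul, _root_.map_sub] using h

theorem resolvent_generator_apply (hε : 0 < ε) (A : S.generator.domain) :
    hS.resolvent ε (S.generator A) = (ε : ℂ)⁻¹ • (hS.resolvent ε A - A) :=
  ((S.generator_spec A).apply_of_commute (hS.isNormalMap_resolvent ε) hS.resolvent_apply).unique
    (hS.generatesAt_resolvent hε A)

/-- The Yosida approximation `L (1 - ε L)⁻¹ = ε⁻¹ ((1 - ε L)⁻¹ - 1)` of the generator `L`. -/
def yosida (ε : ℝ) : (H →L[ℂ] H) →L[ℂ] (H →L[ℂ] H) :=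
  (ε : ℂ)⁻¹ • (hS.resolvent ε - 1)

theorem isResolventComposite_yosida (hε : 0 < ε) :
    IsResolventComposite S.generator ε (hS.yosida ε) :=
  isResolventComposite_of_inverse hε.ne'
    (fun A => ⟨(hS.generatesAt_resolvent hε A).mem_domain,
      (hS.generatesAt_resolvent hε A).generator_eq⟩)
    (hS.resolvent_generator_apply hε)

theorem sigmaWeakTendsto_resolvent (A : H →L[ℂ] H) :
    SigmaWeakTendsto (fun ε => hS.resolvent ε A) (𝓝 0) A := by
  refine sigmaWeakTendsto_iff.2 fun x y => ?_
  have h := tendsto_integral_expLaw (S.continuous_predualFunctional_apply x y A)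
    (hS.norm_predualFunctional_apply_le x y A)
  simpa only [← hS.predualFunctional_resolvent, S.map_zero] using h

theorem sigmaWeakTendsto_yosida (A : S.generator.domain) :
    SigmaWeakTendsto (fun ε => hS.yosida ε A) (𝓝[>] 0) (S.generator A) := by
  refine ((hS.sigmaWeakTendsto_resolvent (S.generator A)).mono_left nhdsWithin_le_nhds).congr' ?_
  filter_upwards [self_mem_nhdsWithin] with ε hε
  exact hS.resolvent_generator_apply hε A

end IsMarkov

end QuantumDynamicalSemigroup

end Resolvent

section BanachAlgebra

variable {𝔸 : Type*} [NormedRing 𝔸] [NormedAlgebra ℂ 𝔸] [CompleteSpace 𝔸]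

theorem exp_add_smul (s t : ℂ) (a : 𝔸) :
    NormedSpace.exp ((s + t) • a) = NormedSpace.exp (s • a) * NormedSpace.exp (t • a) := by
  let := NormedAlgebra.restrictScalars ℚ ℂ 𝔸
  rw [add_smul, NormedSpace.exp_add_of_commute (((Commute.refl a).smul_left s).smul_right t)]

theorem exp_smul_eq_smul_exp_smul_add (t k : ℂ) (a : 𝔸) :
    NormedSpace.exp (t • a) = Complex.exp (-(t * k)) • NormedSpace.exp (t • (a + k • 1)) := by
  let := NormedAlgebra.restrictScalars ℚ ℂ 𝔸
  have hsplit : t • a = algebraMap ℂ 𝔸 (-(t * k)) + t • (a + k • 1) := by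
    rw [smul_add, smul_smul, Algebra.algebraMap_eq_smul_one, neg_smul]
    abel
  rw [hsplit, NormedSpace.exp_add_of_commute (Algebra.commutes _ _),
    ← NormedSpace.algebraMap_exp_comm, ← Complex.exp_eq_exp_ℂ, ← Algebra.smul_def]

theorem continuous_exp_nnreal_smul (a : 𝔸) :
    Continuous fun t : ℝ≥0 => NormedSpace.exp (((t : ℝ) : ℂ) • a) :=
  (differentiable_exp_smul_const ℂ a).continuous.comp
    (Complex.continuous_ofReal.comp NNReal.continuous_coe)

end BanachAlgebra

section BoundedOperators

variable {E : Type*} [NormedAddCommGroup E] [NormedSpace ℂ E] [CompleteSpace E] {M : E →L[ℂ] E}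

theorem exp_apply_of_apply_eq_zero {v : E} (h : M v = 0) : NormedSpace.exp M v = v := by
  have hseries := (NormedSpace.exp_series_hasSum_exp' (𝕂 := ℂ) M).mapL (.apply ℂ E v)
  refine hseries.unique ?_
  have hfirst := hasSum_single
    (f := fun n => ContinuousLinearMap.apply ℂ E v ((n.factorial : ℂ)⁻¹ • M ^ n)) 0
    fun n hn => by
      obtain ⟨k, rfl⟩ := Nat.exists_eq_succ_of_ne_zero hn
      simp [pow_succ, h]
  simpa using hfirst

theorem hasDerivAt_exp_ofReal_smul_apply (M : E →L[ℂ] E) (v : E) :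
    HasDerivAt (fun t : ℝ => NormedSpace.exp ((t : ℂ) • M) v) (M v) 0 := by
  have hexp : HasDerivAt (fun z : ℂ => NormedSpace.exp (z • M)) M ((0 : ℝ) : ℂ) := by
    simpa using hasDerivAt_exp_smul_const M (0 : ℂ)
  have happly : HasDerivAt (fun z : ℂ => NormedSpace.exp (z • M) v) (M v) ((0 : ℝ) : ℂ) :=
    (ContinuousLinearMap.apply ℂ E v).hasFDerivAt.comp_hasDerivAt _ hexp
  simpa using! happly.scomp (0 : ℝ) Complex.ofRealCLM.hasDerivAt

end BoundedOperators

namespace QuantumDynamicalSemigroup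

variable {H : Type*} [NormedAddCommGroup H] [InnerProductSpace ℂ H] [CompleteSpace H]
  {M : (H →L[ℂ] H) →L[ℂ] (H →L[ℂ] H)} {k : ℝ}

theorem exp_nnreal_smul_mem_normalCompletelyPositive
    (h : M + (k : ℂ) • 1 ∈ normalCompletelyPositive H) (t : ℝ≥0) :
    NormedSpace.exp (((t : ℝ) : ℂ) • M) ∈ normalCompletelyPositive H := by
  rw [exp_smul_eq_smul_exp_smul_add _ (k : ℂ) M, ← Complex.ofReal_mul, ← Complex.ofReal_neg,
    ← Complex.ofReal_exp]
  exact Subalgebra.smul_mem _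
    (exp_mem_of_isClosed isClosed_normalCompletelyPositive (Subalgebra.smul_mem _ h t))
    (⟨_, (Real.exp_pos _).le⟩ : ℝ≥0)

/-- The uniformly continuous semigroup `exp (t M)`, for a bounded map `M` which is normal and
completely positive up to a real multiple of the identity map. -/
def expSemigroup (h : M + (k : ℂ) • 1 ∈ normalCompletelyPositive H) :
    QuantumDynamicalSemigroup H where
  T t := NormedSpace.exp (((t : ℝ) : ℂ) • M)
  normal t := (exp_nnreal_smul_mem_normalCompletelyPositive h t).1
  completelyPositive t := (exp_nnreal_smul_mem_normalCompletelyPositive h t).2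
  map_zero A := exp_apply_of_apply_eq_zero (by simp)
  map_add t s A := by
    rw [NNReal.coe_add, Complex.ofReal_add, exp_add_smul _ _ M]
    rfl
  sigmaWeak_continuous A := continuous_sigmaWeak_iff.2 fun x y =>
    (predualCLM x y).continuous.comp ((continuous_exp_nnreal_smul M).clm_apply continuous_const)

variable (h : M + (k : ℂ) • 1 ∈ normalCompletelyPositive H)

theorem isMarkov_expSemigroup (h₁ : M 1 = 0) : (expSemigroup h).IsMarkov := fun t =>
  exp_apply_of_apply_eq_zero (by rw [smul_apply, h₁, smul_zero])

theorem isUniformlyContinuous_expSemigroup : (expSemigroup h).IsUniformlyContinuous :=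
  continuous_exp_nnreal_smul M

theorem generatesAt_expSemigroup (A : H →L[ℂ] H) : (expSemigroup h).GeneratesAt A (M A) := by
  have hslope := tendsto_nnreal_slope_of_hasDerivAt (hasDerivAt_exp_ofReal_smul_apply M A)
  rw [Complex.ofReal_zero, exp_apply_of_apply_eq_zero (by simp)] at hslope
  exact sigmaWeakTendsto_iff.2 fun x y => ((predualCLM x y).continuous.tendsto _).comp hslope

theorem generator_expSemigroup :
    (expSemigroup h).generator = (M : (H →L[ℂ] H) →ₗ[ℂ] (H →L[ℂ] H)).toPMap ⊤ :=
  have hgen := generatesAt_expSemigroup h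
  LinearPMap.ext (Submodule.ext fun A => ⟨fun _ => trivial, fun _ => (hgen A).mem_domain⟩)
    fun A _ _ => (hgen A).generator_eq

end QuantumDynamicalSemigroup

section YosidaLindblad

namespace QuantumDynamicalSemigroup.IsMarkov

variable {H : Type*} [NormedAddCommGroup H] [InnerProductSpace ℂ H] [CompleteSpace H]
  {S : QuantumDynamicalSemigroup H} (hS : S.IsMarkov) {ε : ℝ}

theorem yosida_one (ε : ℝ) : hS.yosida ε 1 = 0 := by
  rw [yosida, smul_apply, sub_apply, hS.resolvent_one, one_apply_eq_self, sub_self, smul_zero]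

theorem inv_smul_resolvent_mem_normalCompletelyPositive (hε : 0 < ε) :
    (ε : ℂ)⁻¹ • hS.resolvent ε ∈ normalCompletelyPositive H := by
  rw [← Complex.ofReal_inv]
  have hmem : hS.resolvent ε ∈ normalCompletelyPositive H :=
    ⟨hS.isNormalMap_resolvent ε, hS.isCompletelyPositive_resolvent ε⟩
  exact Subalgebra.smul_mem _ hmem (⟨ε⁻¹, (inv_pos.2 hε).le⟩ : ℝ≥0)

theorem yosida_add_inv_smul_one_mem_normalCompletelyPositive (hε : 0 < ε) :
    hS.yosida ε + ((ε⁻¹ : ℝ) : ℂ) • 1 ∈ normalCompletelyPositive H := by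
  rw [yosida, Complex.ofReal_inv, smul_sub (ε : ℂ)⁻¹ (hS.resolvent ε), sub_add_cancel]
  exact hS.inv_smul_resolvent_mem_normalCompletelyPositive hε

theorem yosida_apply_eq_lindblad (ε : ℝ) (A : H →L[ℂ] H) :
    hS.yosida ε A = ((ε : ℂ)⁻¹ • hS.resolvent ε) A + (((-(2 * ε)⁻¹ : ℝ) : ℂ) • 1) * A
      + A * star (((-(2 * ε)⁻¹ : ℝ) : ℂ) • (1 : H →L[ℂ] H)) := by
  have hhalves : -(ε : ℂ)⁻¹ = ((-(2 * ε)⁻¹ : ℝ) : ℂ) + ((-(2 * ε)⁻¹ : ℝ) : ℂ) := by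
    push_cast
    ring
  rw [star_smul, star_one, smul_one_mul, mul_smul_one, Complex.star_def, Complex.conj_ofReal,
    add_assoc, ← add_smul, ← hhalves, yosida, smul_sub, sub_eq_add_neg, ← neg_smul]
  rfl

end QuantumDynamicalSemigroup.IsMarkov

end YosidaLindblad

end

theorem theorem3p1 {H : Type*} [NormedAddCommGroup H] [InnerProductSpace ℂ H] [CompleteSpace H]
    (S : QuantumDynamicalSemigroup H) (hS : S.IsMarkov) :
    ∃ Lε : ℝ → (H →L[ℂ] H) →L[ℂ] (H →L[ℂ] H),
      (∀ ε > 0, IsResolventComposite S.generator ε (Lε ε)) ∧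
      (∀ ε > 0, ∃ U : QuantumDynamicalSemigroup H, U.IsMarkov ∧ U.IsUniformlyContinuous ∧
        U.generator = (Lε ε : (H →L[ℂ] H) →ₗ[ℂ] (H →L[ℂ] H)).toPMap ⊤) ∧
      (∀ A : S.generator.domain,
        SigmaWeakTendsto (fun ε => Lε ε A) (𝓝[>] 0) (S.generator A)) ∧
      ∃ (φ : ℝ → (H →L[ℂ] H) →L[ℂ] (H →L[ℂ] H)) (G : ℝ → H →L[ℂ] H),
        (∀ ε > 0, IsNormalMap (φ ε) ∧ IsCompletelyPositive (φ ε)) ∧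
        (∀ ε > 0, ∀ A : H →L[ℂ] H, Lε ε A = φ ε A + G ε * A + A * star (G ε)) ∧
        (∀ A : S.generator.domain,
          SigmaWeakTendsto (fun ε => φ ε A + G ε * (A : H →L[ℂ] H) + (A : H →L[ℂ] H) * star (G ε))
            (𝓝[>] 0) (S.generator A)) := by
  refine ⟨hS.yosida, fun ε => hS.isResolventComposite_yosida, fun ε hε => ?_,
    hS.sigmaWeakTendsto_yosida, fun ε => (ε : ℂ)⁻¹ • hS.resolvent ε,
    fun ε => ((-(2 * ε)⁻¹ : ℝ) : ℂ) • 1,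
    fun ε => hS.inv_smul_resolvent_mem_normalCompletelyPositive,
    fun ε _ => hS.yosida_apply_eq_lindblad ε,
    fun A => (hS.sigmaWeakTendsto_yosida A).congr fun ε => hS.yosida_apply_eq_lindblad ε A⟩
  have hmem := hS.yosida_add_inv_smul_one_mem_normalCompletelyPositive hε
  exact ⟨.expSemigroup hmem,
    QuantumDynamicalSemigroup.isMarkov_expSemigroup hmem (hS.yosida_one ε),
    QuantumDynamicalSemigroup.isUniformlyContinuous_expSemigroup hmem,
    QuantumDynamicalSemigroup.generator_expSemigroup hmem⟩
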